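/- Let $K$ be an algebraically closed field, let $n\ge 4$, and let $X=(x_{ij})$ be the generic $n\times n$ matrix over $K$, with coordinate ring $K[X]=K[x_{ij}\mid 1\le i,j\le n]$. Let $\mathfrak P_{n-1}\subseteq K[X]$ be the ideal generated by the principal minors of size $n-1$ of $X$ (those with the same row and column indices), let $I_{n-1}$ be the ideal generated by all minors of size $n-1$ of $X$, and let $Q_{n-1}$ be the contraction to $K[X]$ of the ideal $\mathfrak P_{n-1}K[X]_{\det X}$ of the localization $K[X]_{\det X}=K[X][1/\det X]$. For a prime ideal $\mathfrak p$ of $K[X]$, call the rank of the image of $X$ over the residue field $\kappa(\mathfrak p)$ the rank at $\mathfrak p$. Then: (1) The minimal primes of $\mathfrak P_{n-1}$ are exactly $I_{n-1}$ and $Q_{n-1}$, and $I_{n-1}\ne Q_{n-1}$. (2) $I_{n-1}$ has height $4$ and $Q_{n-1}$ has height (codimension) $n$. (3) $Q_{n-1}$ is the ideal of the closure, in $\operatorname{Spec} K[X]$, of the set of points of rank $n$ of $V(\mathfrak P_{n-1})$. Equivalently, it is the ideal of all polynomials in $K[X]$ that vanish at every invertible $n\times n$ matrix over $K$ whose principal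 minors of size $n-1$ are all zero. (4) Every prime ideal $\mathfrak p\supseteq\mathfrak P_{n-1}$ of $K[X]$ at which the rank is $n-1$ has height at least $n+1$, and it is not a minimal prime of $\mathfrak P_{n-1}$. So no irreducible component of $V(\mathfrak P_{n-1})$ has a generic point of rank $n-1$. -/

import Mathlib

namespace PrincipalMinors

/-- The coordinate ring `K[X]` of the space of `n × n` matrices, `X` a generic matrix. -/
abbrev CoordRing (K : Type*) [Field K] (n : ℕ) : Type _ :=
  MvPolynomial (Fin n × Fin n) K

/-- The generic `n × n` matrix `X = (x_ij)`. -/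
noncomputable abbrev genericMatrix (K : Type*) [Field K] (n : ℕ) :
    Matrix (Fin n) (Fin n) (CoordRing K n) :=
  Matrix.mvPolynomialX (Fin n) (Fin n) K

/-- The ideal generated by the principal minors of size `t` of `A`. A subset of size `t` of the
indices is given by its increasing enumeration. -/
def principalMinorIdeal {R : Type*} [CommRing R] {n : ℕ} (A : Matrix (Fin n) (Fin n) R) (t : ℕ) :
    Ideal R :=
  Ideal.span (Set.range fun f : Fin t ↪o Fin n => (A.submatrix f f).det)

/-- The determinantal ideal generated by all minors of size `t` of `A`. -/
def determinantalIdeal {R : Type*} [CommRing R] {n : ℕ} (A : Matrix (Fin n) (Fin n) R) (t : ℕ) :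
    Ideal R :=
  Ideal.span (Set.range fun fg : (Fin t ↪o Fin n) × (Fin t ↪o Fin n) =>
    (A.submatrix fg.1 fg.2).det)

/-- The contraction to `K[X]` of the extension to `K[X][1 / det X]` of the ideal of principal
minors of size `t` of the generic matrix. -/
noncomputable def contractedIdeal (K : Type*) [Field K] (n t : ℕ) : Ideal (CoordRing K n) :=
  ((principalMinorIdeal (genericMatrix K n) t).map
    (algebraMap (CoordRing K n) (Localization.Away (genericMatrix K n).det))).comap
    (algebraMap (CoordRing K n) (Localization.Away (genericMatrix K n).det))

/-- The rank of the matrix `X(p)` that a point `p` of `Spec K[X]` defines over its residue field.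
For the prime of an irreducible closed set this is the rank of its generic matrix. -/
noncomputable def rankAt {K : Type*} [Field K] {n : ℕ} (p : PrimeSpectrum (CoordRing K n)) : ℕ :=
  ((genericMatrix K n).map (algebraMap (CoordRing K n) p.asIdeal.ResidueField)).rank

/-- The locally closed set of the points of rank exactly `r` in the zero locus, in `Spec K[X]`,
of the principal minors of size `t`. -/
def rankStratum (K : Type*) [Field K] (n r t : ℕ) : Set (PrimeSpectrum (CoordRing K n)) :=
  {p | principalMinorIdeal (genericMatrix K n) t ≤ p.asIdeal ∧ rankAt p = r}

/-- The invertible `n × n` matrices over `K` all of whose principal minors of size `t` vanish, as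
points of the affine space with coordinates `x_ij`. -/
def invertiblePoints (K : Type*) [Field K] (n t : ℕ) : Set (Fin n × Fin n → K) :=
  {x | IsUnit (Matrix.of fun i j => x (i, j)).det ∧
    ∀ f : Fin t ↪o Fin n, ((Matrix.of fun i j => x (i, j)).submatrix f f).det = 0}

end PrincipalMinors

/-! Write P for the ideal of principal minors, I for the determinantal ideal and Q for the
contraction. P is generated by the n diagonal entries of adj X, so by Krull its minimal primes have
height at most n. Lower bounds on heights come from `card_le_height_ker_add`: if the entries of the
generic matrix of a prime lie in a field generated over K by d elements, the prime has height at
least n² - d.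

Primes over P are sorted by rank. Where det X is invertible, P says that X⁻¹ has zero diagonal, so
inverting the generic hollow matrix parametrizes this locus (`contractedIdeal_eq_ker`); hence Q is
prime, and d = n² - n gives its height. At rank n - 1, generators of the left and right kernels have
disjoint supports, so after scaling they cost only n - 2 parameters together; the height is then at
least n + 1, too large for a minimal prime (`height_ge_of_rankAt_eq`). At smaller rank the prime
contains I.

I is the kernel of the substitution X = YZ (`determinantalIdeal_eq_ker`), hence prime: monomials
without long increasing chains span modulo the minors and stay independent after the substitution.
Its height is 4. It is minimal over P because det X lies in I but not in Q, and a strict inclusion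
of Q in I would force n < 4. -/

namespace PrincipalMinors

/-! ### Exponent matrices with fixed margins, and antichain supports -/

open Finset

/-- The number of units of mass of `a` in the upper right quadrant with corner `(k, l)`. -/
def quadrantSum {n : ℕ} (a : Fin n × Fin n → ℕ) (k l : ℕ) : ℕ :=
  ∑ p, if k ≤ p.1.val ∧ l ≤ p.2.val then a p else 0

/-- The weight of an exponent matrix: the variable `x_ij`, indices starting at `1`, has weight
`i * j`. -/
def weight {n : ℕ} (a : Fin n × Fin n → ℕ) : ℕ :=
  ∑ p, a p * ((p.1.val + 1) * (p.2.val + 1))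

/-- The position with 1-based indices i, j lies in exactly i * j of the quadrants. -/
lemma weight_eq_sum_quadrantSum {n : ℕ} (a : Fin n × Fin n → ℕ) :
    weight a = ∑ k ∈ range n, ∑ l ∈ range n, quadrantSum a k l := by
  have key : ∀ i : Fin n, ∑ k ∈ range n, (if k ≤ i.val then 1 else 0) = i.val + 1 := by
    intro i
    rw [sum_boole]
    have : (range n).filter (· ≤ i.val) = range (i.val + 1) := by
      ext k; simp; omega
    simp [this]
  have hp : ∀ p : Fin n × Fin n, a p * ((p.1.val + 1) * (p.2.val + 1)) =
      ∑ k ∈ range n, ∑ l ∈ range n, if k ≤ p.1.val ∧ l ≤ p.2.val then a p else 0 := by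
    intro p
    rw [← key p.1, ← key p.2, sum_mul_sum, mul_sum]
    refine sum_congr rfl fun k _ => ?_
    rw [mul_sum]
    refine sum_congr rfl fun l _ => ?_
    by_cases h1 : k ≤ p.1.val <;> by_cases h2 : l ≤ p.2.val <;> simp [h1, h2]
  unfold weight quadrantSum
  rw [sum_congr rfl fun p _ => hp p, sum_comm]
  exact sum_congr rfl fun k _ => sum_comm

lemma add_quadrantSum {n : ℕ} (a : Fin n × Fin n → ℕ) (i j : Fin n) :
    a (i, j) + quadrantSum a (i + 1) j + quadrantSum a i (j + 1) =
      quadrantSum a i j + quadrantSum a (i + 1) (j + 1) := by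
  have h : a (i, j) = ∑ p, if p = (i, j) then a p else 0 := by simp
  unfold quadrantSum
  rw [h, ← sum_add_distrib, ← sum_add_distrib, ← sum_add_distrib]
  refine sum_congr rfl fun p _ => ?_
  obtain ⟨p1, p2⟩ := p
  simp only [Prod.mk.injEq, Fin.ext_iff]
  split_ifs <;> omega

lemma quadrantSum_eq_zero {n : ℕ} (a : Fin n × Fin n → ℕ) {k l : ℕ} (h : n ≤ k ∨ n ≤ l) :
    quadrantSum a k l = 0 := by
  refine sum_eq_zero fun p _ => if_neg ?_
  have := p.1.isLt
  have := p.2.isLt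
  omega

/-- Among the nonnegative integer matrices with given row and column sums, one whose support is
an antichain for the strict product order is the unique one of least weight. -/
lemma weight_le_of_antichain {n : ℕ} {a b : Fin n × Fin n → ℕ}
    (hrow : ∀ i, ∑ j, a (i, j) = ∑ j, b (i, j)) (hcol : ∀ j, ∑ i, a (i, j) = ∑ i, b (i, j))
    (ha : ∀ p q, a p ≠ 0 → a q ≠ 0 → p.1 < q.1 → ¬ p.2 < q.2) :
    weight a ≤ weight b ∧ (weight a = weight b → a = b) := by
  -- rows below `k` plus columns below `l`, against the two opposite quadrants
  have hid : ∀ (c : Fin n × Fin n → ℕ) (k l : ℕ),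
      (∑ p, if p.1.val < k ∧ p.2.val < l then c p else 0) + ∑ p, c p =
        quadrantSum c k l + (∑ i, if i.val < k then ∑ j, c (i, j) else 0) +
          ∑ j, if j.val < l then ∑ i, c (i, j) else 0 := by
    intro c k l
    have h1 : (∑ i : Fin n, if i.val < k then ∑ j, c (i, j) else 0) =
        ∑ p : Fin n × Fin n, if p.1.val < k then c p else 0 := by
      rw [Fintype.sum_prod_type]
      exact sum_congr rfl fun i _ => by split_ifs <;> simp
    have h2 : (∑ j : Fin n, if j.val < l then ∑ i, c (i, j) else 0) =
        ∑ p : Fin n × Fin n, if p.2.val < l then c p else 0 := by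
      rw [Fintype.sum_prod_type_right]
      exact sum_congr rfl fun i _ => by split_ifs <;> simp
    rw [h1, h2, quadrantSum, ← sum_add_distrib, ← sum_add_distrib, ← sum_add_distrib]
    refine sum_congr rfl fun p _ => ?_
    split_ifs <;> omega
  have htot : ∑ p, a p = ∑ p, b p := by
    rw [Fintype.sum_prod_type, Fintype.sum_prod_type]
    exact sum_congr rfl fun i _ => hrow i
  -- By `hid` the margins fix the difference of the masses in two opposite quadrants. For `a` one of
  -- the two is empty, so its quadrant sum is the least possible.
  have hle : ∀ k l, quadrantSum a k l ≤ quadrantSum b k l := by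
    intro k l
    have ea := hid a k l
    have eb := hid b k l
    simp only [hrow, hcol, htot] at ea
    by_cases h : ∃ p, a p ≠ 0 ∧ p.1.val < k ∧ p.2.val < l
    · obtain ⟨p, hp, hp1, hp2⟩ := h
      have : quadrantSum a k l = 0 := by
        refine sum_eq_zero fun q _ => ?_
        split_ifs with hq
        · by_contra hq0
          exact ha p q hp hq0 (by rw [Fin.lt_def]; omega) (by rw [Fin.lt_def]; omega)
        · rfl
      omega
    · push Not at h
      have : (∑ p, if p.1.val < k ∧ p.2.val < l then a p else 0) = 0 := by
        refine sum_eq_zero fun q _ => ?_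
        split_ifs with hq
        · by_contra hq0
          have := h q hq0 hq.1
          omega
        · rfl
      omega
  rw [weight_eq_sum_quadrantSum, weight_eq_sum_quadrantSum]
  refine ⟨sum_le_sum fun k _ => sum_le_sum fun l _ => hle k l, fun heq => ?_⟩
  have hM : ∀ k l, quadrantSum a k l = quadrantSum b k l := by
    intro k l
    by_cases hk : n ≤ k ∨ n ≤ l
    · rw [quadrantSum_eq_zero a hk, quadrantSum_eq_zero b hk]
    · push Not at hk
      have h1 := (sum_eq_sum_iff_of_le fun k _ => sum_le_sum fun l _ => hle k l).1 heq k
        (mem_range.2 hk.1)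
      exact (sum_eq_sum_iff_of_le fun l _ => hle k l).1 h1 l (mem_range.2 hk.2)
  -- The entries are second differences of the quadrant sums.
  funext ⟨i, j⟩
  have h1 := add_quadrantSum a i j
  have h2 := add_quadrantSum b i j
  simp only [hM] at h1
  omega

/-- A finite set of positions that contains no strictly increasing chain of length `r + 1` can be
coloured by `r` colours such that each colour class is an antichain. -/
lemma exists_antichain_coloring {n : ℕ} (r : ℕ) (S : Finset (Fin n × Fin n))
    (hS : ¬ ∃ a b : Fin (r + 1) → Fin n, StrictMono a ∧ StrictMono b ∧ ∀ k, (a k, b k) ∈ S) :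
    ∃ κ : Fin n × Fin n → ℕ, (∀ p ∈ S, κ p < r) ∧
      ∀ p ∈ S, ∀ q ∈ S, κ p = κ q → p.1 < q.1 → ¬ p.2 < q.2 := by
  classical
  induction r generalizing S with
  | zero =>
    refine ⟨fun _ => 0, fun p hp => (hS ⟨fun _ => p.1, fun _ => p.2, ?_, ?_, fun _ => hp⟩).elim,
      fun p hp => (hS ⟨fun _ => p.1, fun _ => p.2, ?_, ?_, fun _ => hp⟩).elim⟩ <;>
    · intro i j h; omega
  | succ r ih =>
    -- `T` removes the minimal positions, which form an antichain and receive the last colour. A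
    -- chain in `T` extends downwards by one position of `S`.
    let T := S.filter fun q => ∃ p ∈ S, p.1 < q.1 ∧ p.2 < q.2
    obtain ⟨κ, hκ, hκ'⟩ := ih T (by
      rintro ⟨a, b, ha, hb, hab⟩
      obtain ⟨p, hp, hp1, hp2⟩ := (mem_filter.1 (hab 0)).2
      refine hS ⟨Fin.cons p.1 a, Fin.cons p.2 b, ?_, ?_, ?_⟩
      · exact Fin.strictMono_cons.2 ⟨fun k => hp1.trans_le (ha.monotone (Fin.zero_le k)), ha⟩
      · exact Fin.strictMono_cons.2 ⟨fun k => hp2.trans_le (hb.monotone (Fin.zero_le k)), hb⟩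
      · intro k
        cases k using Fin.cases with
        | zero => simpa using hp
        | succ k => simpa using (mem_filter.1 (hab k)).1)
    refine ⟨fun p => if p ∈ T then κ p else r, fun p hp => ?_, fun p hp q hq h h1 h2 => ?_⟩
    · dsimp only
      split_ifs with h
      · exact (hκ p h).trans (Nat.lt_succ_self r)
      · exact Nat.lt_succ_self r
    · have hqT : q ∈ T := mem_filter.2 ⟨hq, p, hp, h1, h2⟩
      have := hκ q hqT
      by_cases hpT : p ∈ T
      · simp only [hpT, hqT, if_true] at h
        exact hκ' p hpT q hqT h h1 h2
      · simp only [hpT, hqT, if_true, if_false] at h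
        omega

end PrincipalMinors

/-! ### The determinantal ideal as the kernel of X = YZ -/

namespace PrincipalMinors

open Finset MvPolynomial

variable (K : Type*) [Field K]

/-- The generic factorization `X = Y Z` of an `n × n` matrix of rank at most `r`. -/
noncomputable def factorHom (n r : ℕ) :
    CoordRing K n →ₐ[K] MvPolynomial ((Fin r × Fin n) ⊕ (Fin r × Fin n)) K :=
  aeval fun p => ∑ c : Fin r, X (Sum.inl (c, p.1)) * X (Sum.inr (c, p.2))

/-- The exponent of the monomial of the factors that a colouring `g` of the letters of the
monomial with exponent `m` gives. -/
noncomputable def colorContent {n r : ℕ} {m : Fin n × Fin n → ℕ}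
    (g : (Σ p, Fin (m p)) → Fin r) : (Fin r × Fin n) ⊕ (Fin r × Fin n) →₀ ℕ :=
  ∑ e, (Finsupp.single (Sum.inl (g e, e.1.1)) 1 + Finsupp.single (Sum.inr (g e, e.1.2)) 1)

/-- The exponent of the part of a given colour. -/
def colorPart {n r : ℕ} {m : Fin n × Fin n → ℕ} (g : (Σ p, Fin (m p)) → Fin r) (c : Fin r)
    (p : Fin n × Fin n) : ℕ :=
  ∑ k : Fin (m p), if g ⟨p, k⟩ = c then 1 else 0

variable {K}

/-- Expanding the product of the sums over c amounts to choosing a colour for each letter of the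
monomial. -/
lemma factorHom_monomial {n r : ℕ} (m : Fin n × Fin n →₀ ℕ) :
    factorHom K n r (monomial m 1) =
      ∑ g : (Σ p, Fin (m p)) → Fin r, monomial (colorContent g) 1 := by
  have h1 : factorHom K n r (monomial m 1) = ∏ e : (Σ p, Fin (m p)), ∑ c : Fin r,
      (X (Sum.inl (c, e.1.1)) * X (Sum.inr (c, e.1.2)) :
        MvPolynomial ((Fin r × Fin n) ⊕ (Fin r × Fin n)) K) := by
    rw [factorHom, aeval_monomial, map_one, one_mul, Finsupp.prod_fintype _ _ (by simp),
      Fintype.prod_sigma]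
    simp
  rw [h1, prod_univ_sum, Fintype.piFinset_univ]
  refine sum_congr rfl fun g _ => ?_
  rw [colorContent, monomial_sum_one]
  refine prod_congr rfl fun e _ => ?_
  rw [← one_mul (1 : K), ← monomial_mul]
  simp [X]

lemma coeff_factorHom_monomial {n r : ℕ} (m : Fin n × Fin n →₀ ℕ)
    (s : (Fin r × Fin n) ⊕ (Fin r × Fin n) →₀ ℕ) :
    coeff s (factorHom K n r (monomial m 1)) =
      ∑ g : (Σ p, Fin (m p)) → Fin r, if colorContent g = s then 1 else 0 := by
  rw [factorHom_monomial, coeff_sum]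
  simp only [coeff_monomial]

lemma colorContent_inl {n r : ℕ} {m : Fin n × Fin n → ℕ} (g : (Σ p, Fin (m p)) → Fin r)
    (c : Fin r) (i : Fin n) :
    colorContent g (Sum.inl (c, i)) = ∑ j, colorPart g c (i, j) := by
  simp only [colorContent, colorPart, Finsupp.finsetSum_apply, Finsupp.add_apply,
    Finsupp.single_apply, Sum.inl.injEq, Prod.mk.injEq, reduceCtorEq, if_false, add_zero,
    Fintype.sum_sigma, Fintype.sum_prod_type]
  rw [sum_eq_single i]
  · simp
  · intro b _ hb; simp [hb]
  · simp

lemma colorContent_inr {n r : ℕ} {m : Fin n × Fin n → ℕ} (g : (Σ p, Fin (m p)) → Fin r)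
    (c : Fin r) (j : Fin n) :
    colorContent g (Sum.inr (c, j)) = ∑ i, colorPart g c (i, j) := by
  simp only [colorContent, colorPart, Finsupp.finsetSum_apply, Finsupp.add_apply,
    Finsupp.single_apply, Sum.inr.injEq, Prod.mk.injEq, reduceCtorEq, if_false, zero_add,
    Fintype.sum_sigma, Fintype.sum_prod_type]
  rw [sum_comm, sum_eq_single j]
  · simp
  · intro b _ hb; simp [hb]
  · simp

lemma sum_colorPart {n r : ℕ} {m : Fin n × Fin n → ℕ} (g : (Σ p, Fin (m p)) → Fin r)
    (p : Fin n × Fin n) : ∑ c, colorPart g c p = m p := by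
  simp only [colorPart]
  rw [sum_comm]
  simp

lemma sum_weight_colorPart {n r : ℕ} {m : Fin n × Fin n → ℕ} (g : (Σ p, Fin (m p)) → Fin r) :
    ∑ c, weight (colorPart g c) = weight m := by
  simp only [weight]
  rw [sum_comm]
  refine sum_congr rfl fun p _ => ?_
  rw [← sum_mul, sum_colorPart]

/-- If `κ` colours the support of `m` by antichains, then a colouring of a monomial `m'` of weight
at most that of `m` has the same content as `κ` only if it is `κ`. -/
lemma eq_of_colorContent_eq {n r : ℕ} {m m' : Fin n × Fin n → ℕ} (κ : Fin n × Fin n → Fin r)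
    (hκ : ∀ p, m p ≠ 0 → ∀ q, m q ≠ 0 → κ p = κ q → p.1 < q.1 → ¬ p.2 < q.2)
    (hw : weight m' ≤ weight m) (g : (Σ p, Fin (m' p)) → Fin r)
    (hg : colorContent g = colorContent fun e : (Σ p, Fin (m p)) => κ e.1) :
    m' = m ∧ ∀ e, g e = κ e.1 := by
  set k : (Σ p, Fin (m p)) → Fin r := fun e => κ e.1 with hk
  have hkpart : ∀ c p, colorPart k c p = if κ p = c then m p else 0 := by
    intro c p
    simp only [colorPart, hk]
    split_ifs <;> simp
  -- Equal contents give the parts of each colour equal margins, so the antichain parts are the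
  -- lightest. The bound on the total weight then forces equality in every colour.
  have hpart : ∀ c, weight (colorPart k c) ≤ weight (colorPart g c) ∧
      (weight (colorPart k c) = weight (colorPart g c) → colorPart k c = colorPart g c) := by
    intro c
    refine weight_le_of_antichain (fun i => ?_) (fun j => ?_) fun p q hp hq => ?_
    · rw [← colorContent_inl, ← colorContent_inl, hg]
    · rw [← colorContent_inr, ← colorContent_inr, hg]
    · rw [hkpart] at hp hq
      simp only [ne_eq, ite_eq_right_iff, Classical.not_imp] at hp hq
      exact hκ p hp.2 q hq.2 (hp.1.trans hq.1.symm)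
  have hsum : ∑ c, weight (colorPart k c) = ∑ c, weight (colorPart g c) := by
    refine le_antisymm (sum_le_sum fun c _ => (hpart c).1) ?_
    rwa [sum_weight_colorPart, sum_weight_colorPart]
  have heq : ∀ c, colorPart k c = colorPart g c := fun c =>
    (hpart c).2 ((sum_eq_sum_iff_of_le fun c _ => (hpart c).1).1 hsum c (mem_univ c))
  refine ⟨funext fun p => ?_, fun e => ?_⟩
  · rw [← sum_colorPart g, ← sum_colorPart k]
    exact sum_congr rfl fun c _ => by rw [heq]
  · obtain ⟨p, e⟩ := e
    have h1 : colorPart g (g ⟨p, e⟩) p ≠ 0 := by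
      have : (if g ⟨p, e⟩ = g ⟨p, e⟩ then 1 else 0) ≤ colorPart g (g ⟨p, e⟩) p :=
        single_le_sum (f := fun x => if g ⟨p, x⟩ = g ⟨p, e⟩ then 1 else 0)
          (fun _ _ => Nat.zero_le _) (mem_univ e)
      simp only [if_true] at this
      omega
    rw [← heq, hkpart] at h1
    simp only [ne_eq, ite_eq_right_iff, Classical.not_imp] at h1
    exact h1.1.symm

/-- A monomial is standard if its support contains no strictly increasing chain of `t`
positions. -/
def IsStandard {n : ℕ} (t : ℕ) (m : Fin n × Fin n →₀ ℕ) : Prop :=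
  ¬ ∃ a b : Fin t → Fin n, StrictMono a ∧ StrictMono b ∧ ∀ k, m (a k, b k) ≠ 0

/-- Take m of greatest weight in the support and colour it by r antichains. The content of this
colouring arises from no other colouring of a monomial of f, so its coefficient in the image is
exactly that of m in f, in every characteristic. -/
lemma eq_zero_of_factorHom_eq_zero {n r : ℕ} [NeZero r] {f : CoordRing K n}
    (hf : ∀ m ∈ f.support, IsStandard (r + 1) m) (h0 : factorHom K n r f = 0) : f = 0 := by
  classical
  by_contra hne
  obtain ⟨m, hm, hmax⟩ := exists_max_image f.support (fun m => weight m)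
    (MvPolynomial.support_nonempty.2 hne)
  obtain ⟨κ₀, hκ₀, hκ⟩ := exists_antichain_coloring r m.support (by
    simpa [IsStandard] using hf m hm)
  -- Reduction modulo r changes colours only off the support of m, where they do not matter.
  let κ : Fin n × Fin n → Fin r := fun p => Fin.ofNat r (κ₀ p)
  have hκκ : ∀ p, m p ≠ 0 → ∀ q, m q ≠ 0 → κ p = κ q → p.1 < q.1 → ¬ p.2 < q.2 := by
    intro p hp q hq h
    have hp' := Finsupp.mem_support_iff.2 hp
    have hq' := Finsupp.mem_support_iff.2 hq
    refine hκ p hp' q hq' ?_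
    have := congrArg Fin.val h
    simpa [κ, Fin.ofNat, Nat.mod_eq_of_lt (hκ₀ p hp'), Nat.mod_eq_of_lt (hκ₀ q hq')] using this
  set s := colorContent fun e : (Σ p, Fin (m p)) => κ e.1 with hs
  have hcoeff : coeff s (factorHom K n r f) = coeff m f := by
    conv_lhs => rw [f.as_sum, map_sum, coeff_sum]
    have hmon : ∀ m', factorHom K n r (monomial m' (coeff m' f)) =
        coeff m' f • factorHom K n r (monomial m' 1) := by
      intro m'
      rw [← map_smul, smul_monomial, smul_eq_mul, mul_one]
    rw [sum_eq_single m]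
    · rw [hmon, coeff_smul, coeff_factorHom_monomial, sum_eq_single fun e => κ e.1]
      · simp [hs]
      · intro g _ hg
        rw [if_neg]
        intro h
        exact hg (funext (eq_of_colorContent_eq κ hκκ le_rfl g h).2)
      · simp
    · intro m' hm' hmm'
      rw [hmon, coeff_smul, coeff_factorHom_monomial, sum_eq_zero, smul_zero]
      intro g _
      rw [if_neg]
      intro h
      exact hmm' (DFunLike.coe_injective (eq_of_colorContent_eq κ hκκ (hmax m' hm') g h).1)
    · exact fun h => absurd hm h
  rw [h0, coeff_zero] at hcoeff
  exact mem_support_iff.1 hm hcoeff.symm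

/-- The standard monomials generate the coordinate ring modulo the determinantal ideal. -/
lemma monomial_mem_determinantalIdeal_sup {n t : ℕ} (m : Fin n × Fin n →₀ ℕ) :
    (monomial m 1 : CoordRing K n) ∈
      (determinantalIdeal (genericMatrix K n) t).restrictScalars K ⊔
        restrictSupport K {m | IsStandard t m} := by
  classical
  induction hw : weight m using Nat.strong_induction_on generalizing m with
  | _ w ih =>
  by_cases hm : IsStandard t m
  · refine Submodule.mem_sup_right ?_
    rw [mem_restrictSupport_iff]
    intro m' hm'
    have := support_monomial_subset hm'
    rw [mem_singleton] at this
    rwa [this]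
  · rw [IsStandard, not_not] at hm
    obtain ⟨a, b, ha, hb, hab⟩ := hm
    -- Exponents of the terms of the minor on the chain; the diagonal term `d 1` divides the
    -- monomial.
    let d : Equiv.Perm (Fin t) → (Fin n × Fin n →₀ ℕ) :=
      fun σ => ∑ k, Finsupp.single (a (σ k), b k) 1
    have hd1 : d 1 ≤ m := by
      intro p
      simp only [d, Finsupp.finsetSum_apply, Equiv.Perm.coe_one, id, Finsupp.single_apply]
      by_cases hp : ∃ k, (a k, b k) = p
      · obtain ⟨k, hk⟩ := hp
        rw [sum_eq_single k]
        · rw [if_pos hk, ← hk]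
          exact Nat.one_le_iff_ne_zero.2 (hab k)
        · intro l _ hl
          rw [if_neg]
          rintro rfl
          exact hl (ha.injective (Prod.ext_iff.1 hk).1).symm
        · simp
      · rw [sum_eq_zero]
        · exact Nat.zero_le _
        · intro k _
          exact if_neg fun h => hp ⟨k, h⟩
    have hweight : ∀ (u v : Fin n × Fin n →₀ ℕ), weight (u + v : Fin n × Fin n →₀ ℕ) =
        weight u + weight v := by
      intro u v
      simp [weight, add_mul, sum_add_distrib]
    have hwd : ∀ σ, weight (d σ) = ∑ k, ((a (σ k)).val + 1) * ((b k).val + 1) := by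
      intro σ
      simp only [weight, d, Finsupp.finsetSum_apply, sum_mul]
      rw [sum_comm]
      refine sum_congr rfl fun k _ => ?_
      simp [Finsupp.single_apply]
    -- By the rearrangement inequality the diagonal term is strictly the heaviest, so rewriting it
    -- by the minor lowers the weight.
    have hlt : ∀ σ, σ ≠ 1 → weight (d σ) < weight (d 1) := by
      intro σ hσ
      rw [hwd, hwd]
      have hmono : Monovary (fun k => (a k).val + 1) (fun k => (b k).val + 1) := by
        intro i j hij
        have h : i < j := hb.lt_iff_lt.1 (by rw [Fin.lt_def]; simpa using hij)
        have := Fin.lt_def.1 (ha h)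
        dsimp only
        omega
      refine (Monovary.sum_comp_perm_mul_lt_sum_mul_iff (σ := σ) hmono).2 fun hσ' => hσ ?_
      have hσm : StrictMono σ := by
        refine Monotone.strictMono_of_injective (fun i j hij => ?_) σ.injective
        rcases hij.eq_or_lt with rfl | hij
        · exact le_rfl
        · have := hσ' (i := i) (j := j) (by simpa using hb hij)
          exact ha.le_iff_le.1 (by rw [Fin.le_def]; simpa using this)
      ext k
      have := Subsingleton.elim (hσm.orderIsoOfSurjective σ σ.surjective) (OrderIso.refl _)
      exact congrArg Fin.val (DFunLike.congr_fun this k)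
    have hprod : ∀ σ : Equiv.Perm (Fin t),
        (∏ k, genericMatrix K n (a (σ k)) (b k)) = monomial (d σ) 1 := by
      intro σ
      simp only [d]
      rw [monomial_sum_one]
      rfl
    have hdet : (monomial m 1 : CoordRing K n) =
        monomial (m - d 1) 1 * ((genericMatrix K n).submatrix a b).det -
          ∑ σ ∈ univ.erase (1 : Equiv.Perm (Fin t)),
            (Equiv.Perm.sign σ : ℤ) • monomial (m - d 1 + d σ) 1 := by
      rw [Matrix.det_apply']
      simp only [Matrix.submatrix_apply, hprod]
      rw [← add_sum_erase _ _ (mem_univ (1 : Equiv.Perm (Fin t)))]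
      rw [mul_add, mul_sum]
      simp only [Equiv.Perm.sign_one, Units.val_one, Int.cast_one, one_mul, monomial_mul,
        tsub_add_cancel_of_le hd1, mul_one]
      rw [add_sub_assoc, left_eq_add, sub_eq_zero]
      refine sum_congr rfl fun σ _ => ?_
      rw [zsmul_eq_mul, mul_left_comm, monomial_mul, one_mul]
    rw [hdet]
    refine sub_mem (Submodule.mem_sup_left ?_) (sum_mem fun σ hσ => zsmul_mem (ih _ ?_ _ rfl) _)
    · refine Ideal.mul_mem_left _ _ (Ideal.subset_span ⟨(OrderEmbedding.ofStrictMono a ha,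
        OrderEmbedding.ofStrictMono b hb), rfl⟩)
    · have h1 := hlt σ (ne_of_mem_erase hσ)
      have h2 := hweight (m - d 1) (d σ)
      have h3 := hweight (m - d 1) (d 1)
      rw [tsub_add_cancel_of_le hd1] at h3
      omega

lemma det_mul_eq_zero_of_card_lt {R ι κ : Type*} [CommRing R] [IsDomain R] [Fintype ι]
    [DecidableEq ι] [Fintype κ] (h : Fintype.card κ < Fintype.card ι) (A : Matrix ι κ R)
    (B : Matrix κ ι R) : (A * B).det = 0 := by
  rw [← Matrix.exists_mulVec_eq_zero_iff]
  obtain ⟨v, hv, hv'⟩ : ∃ v ≠ 0, B.mulVec v = 0 := by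
    by_contra! hB
    refine absurd (card_le_of_injective R B.mulVecLin ?_) h.not_ge
    refine (injective_iff_map_eq_zero _).2 fun v hv => ?_
    by_contra hv0
    exact hB v hv0 hv
  exact ⟨v, hv, by rw [← Matrix.mulVec_mulVec, hv', Matrix.mulVec_zero]⟩

variable (K) in
/-- The left factor of the generic matrix of rank `r`. -/
noncomputable def leftFactor (n r : ℕ) :
    Matrix (Fin n) (Fin r) (MvPolynomial ((Fin r × Fin n) ⊕ (Fin r × Fin n)) K) :=
  Matrix.of fun i c => X (Sum.inl (c, i))

variable (K) in
/-- The right factor of the generic matrix of rank `r`. -/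
noncomputable def rightFactor (n r : ℕ) :
    Matrix (Fin r) (Fin n) (MvPolynomial ((Fin r × Fin n) ⊕ (Fin r × Fin n)) K) :=
  Matrix.of fun c j => X (Sum.inr (c, j))

lemma genericMatrix_map_factorHom (n r : ℕ) :
    (genericMatrix K n).map (factorHom K n r) = leftFactor K n r * rightFactor K n r := by
  ext1 i j
  simp [factorHom, Matrix.mul_apply, leftFactor, rightFactor]

/-- The determinantal ideal is the ideal of the relations between the entries of the product of
two generic matrices. -/
theorem determinantalIdeal_eq_ker (n r : ℕ) [NeZero r] :
    determinantalIdeal (genericMatrix K n) (r + 1) = RingHom.ker (factorHom K n r) := by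
  have hle : determinantalIdeal (genericMatrix K n) (r + 1) ≤ RingHom.ker (factorHom K n r) := by
    rw [determinantalIdeal, Ideal.span_le]
    rintro _ ⟨fg, rfl⟩
    rw [SetLike.mem_coe, RingHom.mem_ker, AlgHom.map_det, AlgHom.mapMatrix_apply,
      ← Matrix.submatrix_map, genericMatrix_map_factorHom,
      Matrix.submatrix_mul _ _ fg.1 id fg.2 Function.bijective_id]
    exact det_mul_eq_zero_of_card_lt (by simp) _ _
  refine le_antisymm hle fun f hf => ?_
  have hmem : f ∈ (determinantalIdeal (genericMatrix K n) (r + 1)).restrictScalars K ⊔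
      restrictSupport K {m | IsStandard (r + 1) m} := by
    rw [f.as_sum]
    refine sum_mem fun m _ => ?_
    rw [← mul_one (coeff m f), ← smul_eq_mul, ← smul_monomial]
    exact Submodule.smul_mem _ _ (monomial_mem_determinantalIdeal_sup m)
  -- The standard part `g` is also in the kernel, hence zero.
  obtain ⟨u, hu, g, hg, rfl⟩ := Submodule.mem_sup.1 hmem
  have hg0 : factorHom K n r g = 0 := by
    have h1 : factorHom K n r u = 0 := hle hu
    have h2 : factorHom K n r (u + g) = 0 := hf
    rwa [map_add, h1, zero_add] at h2
  rw [eq_zero_of_factorHom_eq_zero ((mem_restrictSupport_iff K).1 hg) hg0, add_zero]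
  exact hu

instance isPrime_determinantalIdeal (n r : ℕ) [NeZero r] :
    (determinantalIdeal (genericMatrix K n) (r + 1)).IsPrime := by
  rw [determinantalIdeal_eq_ker]
  exact RingHom.ker_isPrime _

end PrincipalMinors

/-! ### Lower bounds for heights of kernels in polynomial rings -/

namespace PrincipalMinors

/-- Going down holds for R → R[T], so the height of P is that of its contraction p plus that of P /
pR[T]; the second is nonzero because of g. -/
lemma height_comap_C_add_one_le {R : Type*} [CommRing R] [IsNoetherianRing R]
    (P : Ideal (Polynomial R)) [P.IsPrime] {g : Polynomial R} (hg : g ∈ P)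
    (hg' : g ∉ (P.comap Polynomial.C).map Polynomial.C) :
    (P.comap Polynomial.C).height + 1 ≤ P.height := by
  set p := P.comap Polynomial.C
  have : P.LiesOver p := ⟨rfl⟩
  rw [Ideal.height_eq_height_add_of_liesOver_of_hasGoingDown p P]
  have : IsDomain (Polynomial R ⧸ p.map (algebraMap R (Polynomial R))) := by
    rw [Ideal.Quotient.isDomain_iff_prime]
    exact Ideal.isPrime_map_C_of_isPrime
  gcongr
  rw [Order.one_le_iff_ne_zero, Ne, Ideal.height_eq_zero_iff_eq_bot]
  intro h
  rw [Ideal.map_eq_bot_iff_le_ker, Ideal.mk_ker] at h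
  exact hg' (h hg)

/-- Variables are adjoined one at a time. Each algebraic relation has coefficients in R, which
injects into L, so it is not in the extension of the previous kernel and raises the height. -/
lemma card_le_height_ker_eval₂Hom {R L ι : Type*} [CommRing R] [IsNoetherianRing R]
    [Field L] [Finite ι] (f : R →+* L) (hf : Function.Injective f) (x : ι → L)
    (hx : ∀ i, ∃ g : Polynomial R, g ≠ 0 ∧ g.eval₂ f (x i) = 0) :
    (Nat.card ι : ℕ∞) ≤ (RingHom.ker (MvPolynomial.eval₂Hom f x)).height := by
  induction ι using Finite.induction_empty_option with
  | of_equiv e ih =>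
    have h := ih (fun a => x (e a)) fun a => hx (e a)
    rw [← Nat.card_congr e]
    have hcomp : (MvPolynomial.eval₂Hom f fun a => x (e a)) =
        (MvPolynomial.eval₂Hom f x).comp
          (MvPolynomial.renameEquiv R e).toRingEquiv.toRingHom := by
      ext <;> simp
    rw [hcomp, ← RingHom.comap_ker] at h
    exact h.trans_eq (RingEquiv.height_comap (MvPolynomial.renameEquiv R e).toRingEquiv _)
  | h_empty => simp
  | @h_option ι _ ih =>
    have : Finite ι := Finite.of_fintype ι
    set q := RingHom.ker (MvPolynomial.eval₂Hom f fun i => x (some i)) with hq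
    set Φ := Polynomial.eval₂RingHom (MvPolynomial.eval₂Hom f fun i => x (some i)) (x none)
    have hcomp : MvPolynomial.eval₂Hom f x =
        Φ.comp (MvPolynomial.optionEquivLeft R ι).toRingEquiv.toRingHom := by
      ext i
      · simp [Φ]
      · cases i <;> simp [Φ]
    have hcq : (RingHom.ker Φ).comap Polynomial.C = q := by
      ext a
      simp [Φ, hq, RingHom.mem_ker]
    obtain ⟨g, hg0, hg⟩ := hx none
    have : (RingHom.ker Φ).IsPrime := RingHom.ker_isPrime Φ
    have hf' : (MvPolynomial.eval₂Hom f fun i => x (some i)).comp MvPolynomial.C = f := by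
      ext; simp
    have key := height_comap_C_add_one_le (RingHom.ker Φ)
      (g := g.map MvPolynomial.C) (by
        rwa [RingHom.mem_ker, Polynomial.coe_eval₂RingHom, Polynomial.eval₂_map, hf']) (by
        rw [hcq, Ideal.mem_map_C_iff]
        intro h
        refine hg0 (Polynomial.ext fun k => ?_)
        have := h k
        rw [Polynomial.coeff_map, hq, RingHom.mem_ker, MvPolynomial.eval₂Hom_C] at this
        rw [Polynomial.coeff_zero]
        exact hf (this.trans (map_zero f).symm))
    rw [hcomp, ← RingHom.comap_ker]
    refine le_trans ?_ (RingEquiv.height_comap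
      (MvPolynomial.optionEquivLeft R ι).toRingEquiv (RingHom.ker Φ)).ge
    rw [hcq] at key
    refine le_trans ?_ key
    have := ih (fun i => x (some i)) fun i => hx (some i)
    rw [Finite.card_option]
    push_cast
    gcongr

/-- If the images of the variables lie in a field generated by `d` elements, then the kernel has
codimension at most `d`. -/
theorem card_le_height_ker_add {K L σ : Type*} [Field K] [Field L] [Algebra K L] [Finite σ]
    (φ : MvPolynomial σ K →ₐ[K] L) (s : Finset L)
    (hs : ∀ i, φ (MvPolynomial.X i) ∈ IntermediateField.adjoin K (s : Set L)) :
    (Nat.card σ : ℕ∞) ≤ (RingHom.ker φ).height + s.card := by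
  classical
  set x : σ → L := fun i => φ (MvPolynomial.X i) with hx
  -- A transcendence basis chosen among the images of the variables.
  obtain ⟨B, hB, hBmax⟩ : ∃ B : Set σ, AlgebraicIndepOn K x B ∧
      ∀ i, IsAlgebraic (Algebra.adjoin K (x '' B)) (x i) := by
    obtain ⟨B, hB⟩ := Set.Finite.exists_maximal
      (Set.toFinite {B : Set σ | AlgebraicIndepOn K x B})
      ⟨∅, (algebraicIndependent_empty_type_iff ..).2 (algebraMap K L).injective⟩
    refine ⟨B, hB.1, fun i => ?_⟩
    by_contra hi
    have hmem := hB.2 (AlgebraicIndepOn.insert hB.1 hi) (Set.subset_insert i B)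
      (Set.mem_insert i B)
    exact hi (isAlgebraic_algebraMap
      (⟨x i, Algebra.subset_adjoin ⟨i, hmem, rfl⟩⟩ : Algebra.adjoin K (x '' B)))
  -- The exchange property, through the matroid of algebraic independence.
  have hcard : Nat.card B ≤ s.card := by
    have hsub : x '' B ⊆ (AlgebraicIndependent.matroid K L).closure s := by
      rintro _ ⟨i, -, rfl⟩
      rw [AlgebraicIndependent.matroid_closure_eq]
      obtain ⟨a, ha, b, hb, hab⟩ := IntermediateField.mem_adjoin_iff_div.1 (hs i)
      rw [SetLike.mem_coe, Subalgebra.mem_algebraicClosure]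
      simp only [hx, hab, div_eq_mul_inv]
      exact (isAlgebraic_algebraMap (⟨a, ha⟩ : Algebra.adjoin K (s : Set L))).mul
        (isAlgebraic_algebraMap (⟨b, hb⟩ : Algebra.adjoin K (s : Set L))).inv
    have hind : (AlgebraicIndependent.matroid K L).Indep (x '' B) :=
      AlgebraicIndependent.matroid_indep_iff.2 hB.image
    have h := hind.encard_le_eRk_of_subset hsub
    rw [Matroid.eRk_closure_eq] at h
    have h' := h.trans (Matroid.eRk_le_encard _ _)
    have hinj : Set.InjOn x B := by
      rw [Set.injOn_iff_injective]
      exact AlgebraicIndependent.injective hB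
    rw [hinj.encard_image, Set.encard_coe_eq_coe_finsetCard, Set.encard, ENat.card_eq_coe_natCard]
      at h'
    exact_mod_cast h'
  -- The polynomial ring is now read as one in the variables outside `B`, with coefficient ring
  -- `MvPolynomial B K` embedded in L.
  set f : MvPolynomial B K →+* L := (MvPolynomial.aeval fun b : B => x b : _ →ₐ[K] L).toRingHom
  have hf : Function.Injective f := hB
  have h := card_le_height_ker_eval₂Hom f hf (fun i : (Bᶜ : Set σ) => x i) (by
    intro i
    have hi := hBmax i
    rw [Set.image_eq_range] at hi
    obtain ⟨p, hp0, hp⟩ := hi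
    let ψ := (AlgebraicIndependent.aevalEquiv hB).symm
    have hψ : f.comp (RingHomClass.toRingHom ψ) = algebraMap _ L := by
      ext a
      obtain ⟨a, rfl⟩ := (AlgebraicIndependent.aevalEquiv hB).surjective a
      simp [ψ, f]
    refine ⟨p.map (RingHomClass.toRingHom ψ), ?_, ?_⟩
    · exact (Polynomial.map_ne_zero_iff ψ.injective).2 hp0
    · rw [Polynomial.eval₂_map, hψ]
      exact hp)
  set e : MvPolynomial σ K ≃ₐ[K] MvPolynomial (Bᶜ : Set σ) (MvPolynomial B K) :=
    (MvPolynomial.renameEquiv K ((Equiv.sumComm _ _).trans (Equiv.Set.sumCompl B)).symm).trans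
      (MvPolynomial.sumAlgEquiv K _ _)
  have hcomp : (φ : MvPolynomial σ K →+* L) =
      (MvPolynomial.eval₂Hom f fun i : (Bᶜ : Set σ) => x i).comp (e : MvPolynomial σ K →+* _) := by
    ext i
    · simp [e, f]
    · by_cases hi : i ∈ B
      · simp [e, f, x, Equiv.Set.sumCompl_symm_apply_of_mem hi]
      · simp [e, f, x, Equiv.Set.sumCompl_symm_apply_of_notMem hi]
  have hker : RingHom.ker φ = (RingHom.ker (MvPolynomial.eval₂Hom f fun i : (Bᶜ : Set σ) => x i)).comap
      e.toRingEquiv := by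
    ext a
    have := DFunLike.congr_fun hcomp a
    rw [RingHom.mem_ker, Ideal.mem_comap, RingHom.mem_ker]
    exact Eq.congr_left this
  rw [hker, RingEquiv.height_comap]
  have hσ : Nat.card σ = Nat.card (Bᶜ : Set σ) + Nat.card B := by
    rw [add_comm, ← Nat.card_sum, Nat.card_congr (Equiv.Set.sumCompl B)]
  rw [hσ]
  push_cast
  gcongr

end PrincipalMinors

/-! ### Invertible matrices whose inverse has zero diagonal -/

namespace PrincipalMinors

section General

lemma map_inv_of_isUnit_det {R S : Type*} [CommRing R] [CommRing S] {n : ℕ}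
    (A : Matrix (Fin n) (Fin n) R) (hA : IsUnit A.det) (f : R →+* S) :
    (A⁻¹).map f = (A.map f)⁻¹ := by
  refine (Matrix.inv_eq_right_inv ?_).symm
  rw [← Matrix.map_mul, Matrix.mul_nonsing_inv _ hA, Matrix.map_one _ f.map_zero f.map_one]

/-- The principal minors of corank one are the diagonal entries of the adjugate. -/
lemma principalMinorIdeal_eq_span_adjugate {R : Type*} [CommRing R] {m : ℕ}
    (A : Matrix (Fin (m + 1)) (Fin (m + 1)) R) :
    principalMinorIdeal A m = Ideal.span (Set.range fun i => A.adjugate i i) := by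
  have hadj : ∀ i, A.adjugate i i = (A.submatrix i.succAbove i.succAbove).det := by
    intro i
    rw [Matrix.adjugate_fin_succ_eq_det_submatrix, Even.neg_one_pow ⟨_, rfl⟩, one_mul]
  rw [principalMinorIdeal]
  congr 1
  ext x
  constructor
  · rintro ⟨f, rfl⟩
    obtain ⟨i, hi⟩ : ∃ i, i ∉ Set.range f := by
      by_contra! h
      have := Fintype.card_le_of_surjective f h
      simp at this
    refine ⟨i, ?_⟩
    -- An increasing enumeration is determined by its range, here the complement of one index.
    have hfi : f = Fin.succAboveOrderEmb i := by
      have hsub : Set.range f ⊆ Set.range i.succAbove := by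
        rintro _ ⟨k, rfl⟩
        rw [Fin.range_succAbove, Set.mem_compl_singleton_iff]
        exact fun h => hi ⟨k, h⟩
      have heq : Set.range f = Set.range i.succAbove := by
        refine Set.eq_of_subset_of_ncard_le hsub ?_
        rw [← Set.image_univ, ← Set.image_univ, Set.ncard_image_of_injective _ f.injective,
          Set.ncard_image_of_injective _ Fin.succAbove_right_injective]
      exact DFunLike.coe_injective
        ((f.strictMono.range_inj (Fin.strictMono_succAbove i)).1 heq)
    dsimp only
    rw [hadj, hfi]
    rfl
  · rintro ⟨i, rfl⟩
    exact ⟨Fin.succAboveOrderEmb i, (hadj i).symm⟩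

lemma principalMinorIdeal_le_determinantalIdeal {R : Type*} [CommRing R] {n : ℕ}
    (A : Matrix (Fin n) (Fin n) R) (t : ℕ) : principalMinorIdeal A t ≤ determinantalIdeal A t :=
  Ideal.span_mono (by rintro _ ⟨f, rfl⟩; exact ⟨(f, f), rfl⟩)

lemma det_mem_determinantalIdeal {R : Type*} [CommRing R] {m : ℕ}
    (A : Matrix (Fin (m + 1)) (Fin (m + 1)) R) : A.det ∈ determinantalIdeal A m := by
  rw [Matrix.det_succ_row_zero]
  refine sum_mem fun j _ => Ideal.mul_mem_left _ _ (Ideal.subset_span ?_)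
  exact ⟨(Fin.succOrderEmb m, Fin.succAboveOrderEmb j), rfl⟩

/-- The entries of the inverse of a matrix over a subfield lie in the subfield. -/
lemma inv_apply_mem {K L : Type*} [Field K] [Field L] [Algebra K L] {n : ℕ}
    (F : IntermediateField K L) (A : Matrix (Fin n) (Fin n) L) (hA : ∀ i j, A i j ∈ F)
    (i j : Fin n) : A⁻¹ i j ∈ F := by
  let B : Matrix (Fin n) (Fin n) F := Matrix.of fun i j => ⟨A i j, hA i j⟩
  have hB : B.map (algebraMap F L) = A := rfl
  have hdet : A.det = algebraMap F L B.det := by rw [← hB, RingHom.map_det]; rfl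
  have hadj : A.adjugate i j = algebraMap F L (B.adjugate i j) := by
    rw [← hB, ← RingHom.mapMatrix_apply, ← RingHom.map_adjugate]; rfl
  rw [Matrix.inv_def, Ring.inverse_eq_inv', Matrix.smul_apply, smul_eq_mul, hdet, hadj]
  exact mul_mem (inv_mem (SetLike.coe_mem _)) (SetLike.coe_mem _)

end General

section Contracted

variable (K : Type*) [Field K]

lemma principalMinorIdeal_le_contractedIdeal (n t : ℕ) :
    principalMinorIdeal (genericMatrix K n) t ≤ contractedIdeal K n t :=
  Ideal.le_comap_map

-- A homomorphism that inverts det X factors through the localization.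
variable {K} in
lemma contractedIdeal_le_ker {n t : ℕ} {S : Type*} [CommRing S] (g : CoordRing K n →+* S)
    (hdet : IsUnit (g (genericMatrix K n).det))
    (hg : principalMinorIdeal (genericMatrix K n) t ≤ RingHom.ker g) :
    contractedIdeal K n t ≤ RingHom.ker g := by
  intro f hf
  have hle : (principalMinorIdeal (genericMatrix K n) t).map
      (algebraMap (CoordRing K n) (Localization.Away (genericMatrix K n).det)) ≤
      RingHom.ker (IsLocalization.Away.lift (S := Localization.Away (genericMatrix K n).det)
        _ hdet) := by
    rw [Ideal.map_le_iff_le_comap]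
    intro p hp
    rw [Ideal.mem_comap, RingHom.mem_ker, IsLocalization.Away.lift_eq]
    exact hg hp
  have := hle hf
  rwa [RingHom.mem_ker, IsLocalization.Away.lift_eq] at this

lemma contractedIdeal_le_of_det_notMem {n t : ℕ} (p : Ideal (CoordRing K n)) [p.IsPrime]
    (hp : principalMinorIdeal (genericMatrix K n) t ≤ p) (hdet : (genericMatrix K n).det ∉ p) :
    contractedIdeal K n t ≤ p := by
  have h := contractedIdeal_le_ker (algebraMap (CoordRing K n) p.ResidueField)
    (isUnit_iff_ne_zero.2 fun h => hdet (Ideal.algebraMap_residueField_eq_zero.1 h))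
    (t := t) (by rwa [Ideal.ker_algebraMap_residueField])
  rwa [Ideal.ker_algebraMap_residueField] at h

/-- The generic matrix with zero diagonal. -/
noncomputable def hollowMatrix (n : ℕ) : Matrix (Fin n) (Fin n) (CoordRing K n) :=
  Matrix.of fun i j => if i = j then 0 else MvPolynomial.X (i, j)

/-- The permutation matrix of a full cycle is hollow with determinant ±1; this needs size at least
2. -/
lemma det_hollowMatrix_ne_zero (m : ℕ) : (hollowMatrix K (m + 2)).det ≠ 0 := by
  intro h
  set σ := finRotate (m + 2)
  have hmap : (hollowMatrix K (m + 2)).map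
      (MvPolynomial.eval fun p : Fin (m + 2) × Fin (m + 2) => σ.permMatrix K p.1 p.2) =
      σ.permMatrix K := by
    ext i j
    simp only [hollowMatrix, Matrix.map_apply, Matrix.of_apply]
    split_ifs with hij
    · subst hij
      have : σ i ≠ i := by
        simp only [σ, finRotate_apply, ne_eq, add_eq_left]
        exact one_ne_zero
      simp [Equiv.Perm.permMatrix, PEquiv.toMatrix_apply, this]
    · simp
  have h' := congrArg
    (MvPolynomial.eval fun p : Fin (m + 2) × Fin (m + 2) => σ.permMatrix K p.1 p.2) h
  rw [RingHom.map_det, RingHom.mapMatrix_apply, hmap, Matrix.det_permutation, map_zero] at h'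
  rcases Int.units_eq_one_or (Equiv.Perm.sign σ) with hs | hs <;> simp [hs] at h'

/-- The generic matrix with zero diagonal, over the ring in which it is invertible. -/
noncomputable def hollowUnit (n : ℕ) :
    Matrix (Fin n) (Fin n) (Localization.Away (hollowMatrix K n).det) :=
  (hollowMatrix K n).map (algebraMap _ _)

lemma hollowUnit_apply_self (n : ℕ) (i : Fin n) : hollowUnit K n i i = 0 := by
  have : hollowMatrix K n i i = 0 := by simp [hollowMatrix]
  rw [hollowUnit, Matrix.map_apply, this, map_zero]

lemma isUnit_det_hollowUnit (n : ℕ) : IsUnit (hollowUnit K n).det := by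
  have : (hollowUnit K n).det = algebraMap _ _ (hollowMatrix K n).det := by
    rw [RingHom.map_det]; rfl
  rw [this]
  exact IsLocalization.Away.algebraMap_isUnit _

/-- The generic invertible matrix whose principal minors of corank one vanish. -/
noncomputable def inverseHom (n : ℕ) :
    CoordRing K n →ₐ[K] Localization.Away (hollowMatrix K n).det :=
  MvPolynomial.aeval fun p => (hollowUnit K n)⁻¹ p.1 p.2

lemma genericMatrix_map_inverseHom (n : ℕ) :
    (genericMatrix K n).map (inverseHom K n).toRingHom = (hollowUnit K n)⁻¹ := by
  ext i j
  simp [inverseHom]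

lemma isUnit_inverseHom_det (n : ℕ) :
    IsUnit ((inverseHom K n).toRingHom (genericMatrix K n).det) := by
  rw [RingHom.map_det, RingHom.mapMatrix_apply, genericMatrix_map_inverseHom,
    Matrix.isUnit_nonsing_inv_det_iff]
  exact isUnit_det_hollowUnit K n

/-- Universality of `inverseHom`: q(X)⁻¹ is hollow, so the generic hollow matrix specializes to it,
and inverting again factors q through `inverseHom`. -/
lemma ker_inverseHom_le {m : ℕ} {S : Type*} [CommRing S] (q : CoordRing K (m + 1) →+* S)
    (hdet : IsUnit (q (genericMatrix K (m + 1)).det))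
    (hq : principalMinorIdeal (genericMatrix K (m + 1)) m ≤ RingHom.ker q) :
    RingHom.ker (inverseHom K (m + 1)) ≤ RingHom.ker q := by
  intro f hf
  set M := (genericMatrix K (m + 1)).map q with hM
  have hMdet : IsUnit M.det := by
    rw [hM, ← RingHom.mapMatrix_apply, ← RingHom.map_det]
    exact hdet
  have hMdiag : ∀ i, M⁻¹ i i = 0 := by
    intro i
    have : M.adjugate i i = 0 := by
      rw [hM, ← RingHom.mapMatrix_apply, ← RingHom.map_adjugate, RingHom.mapMatrix_apply,
        Matrix.map_apply]
      refine hq ?_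
      rw [principalMinorIdeal_eq_span_adjugate]
      exact Ideal.subset_span ⟨i, rfl⟩
    rw [Matrix.inv_def, Matrix.smul_apply, this, smul_zero]
  let z : CoordRing K (m + 1) →+* S := 
    MvPolynomial.eval₂Hom (q.comp MvPolynomial.C) fun p => M⁻¹ p.1 p.2
  have hz : (hollowMatrix K (m + 1)).map z = M⁻¹ := by
    ext i j
    simp only [hollowMatrix, Matrix.map_apply, Matrix.of_apply]
    split_ifs with hij
    · rw [hij, hMdiag, map_zero]
    · simp [z]
  have hzdet : IsUnit (z (hollowMatrix K (m + 1)).det) := by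
    rw [RingHom.map_det, RingHom.mapMatrix_apply, hz, Matrix.isUnit_nonsing_inv_det_iff]
    exact hMdet
  let z' : Localization.Away (hollowMatrix K (m + 1)).det →+* S :=
    IsLocalization.Away.lift _ hzdet
  have hz' : ∀ a, z' (algebraMap (CoordRing K (m + 1)) _ a) = z a :=
    IsLocalization.Away.lift_eq _ hzdet
  have hzU : (hollowUnit K (m + 1)).map z' = M⁻¹ := by
    rw [← hz, hollowUnit, Matrix.map_map]
    ext i j
    exact hz' _
  have hcomp : z'.comp (inverseHom K (m + 1)).toRingHom = q := by
    refine MvPolynomial.ringHom_ext (fun a => ?_) fun p => ?_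
    · have : (inverseHom K (m + 1)).toRingHom (MvPolynomial.C a) =
          algebraMap (CoordRing K (m + 1)) _ (MvPolynomial.C a) := by
        exact ((inverseHom K (m + 1)).commutes a).trans
          (IsScalarTower.algebraMap_apply K (CoordRing K (m + 1)) _ a)
      rw [RingHom.comp_apply, this, hz']
      simp [z]
    · have h1 : (inverseHom K (m + 1)).toRingHom (MvPolynomial.X p) =
          (hollowUnit K (m + 1))⁻¹ p.1 p.2 := by simp [inverseHom]
      rw [RingHom.comp_apply, h1, ← Matrix.map_apply (f := z') (M := (hollowUnit K (m + 1))⁻¹),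
        map_inv_of_isUnit_det _ (isUnit_det_hollowUnit K (m + 1)), hzU,
        Matrix.nonsing_inv_nonsing_inv _ hMdet]
      rfl
  have hf' : (inverseHom K (m + 1)).toRingHom f = 0 := hf
  rw [RingHom.mem_ker, ← hcomp, RingHom.comp_apply, hf', map_zero]

theorem contractedIdeal_eq_ker (m : ℕ) :
    contractedIdeal K (m + 1) m = RingHom.ker (inverseHom K (m + 1)) := by
  refine le_antisymm ?_ fun f hf => ?_
  · refine contractedIdeal_le_ker (inverseHom K (m + 1)).toRingHom
      (isUnit_inverseHom_det K (m + 1)) ?_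
    rw [principalMinorIdeal_eq_span_adjugate, Ideal.span_le]
    rintro _ ⟨i, rfl⟩
    have h : (inverseHom K (m + 1)).toRingHom
        ((genericMatrix K (m + 1)).adjugate i i) = ((hollowUnit K (m + 1))⁻¹).adjugate i i := by
      rw [← genericMatrix_map_inverseHom, ← RingHom.mapMatrix_apply, ← RingHom.map_adjugate]
      rfl
    have hu := isUnit_det_hollowUnit K (m + 1)
    have hadj : ((hollowUnit K (m + 1))⁻¹).adjugate =
        ((hollowUnit K (m + 1))⁻¹).det • hollowUnit K (m + 1) := by
      calc ((hollowUnit K (m + 1))⁻¹).adjugate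
          = ((hollowUnit K (m + 1))⁻¹).adjugate * ((hollowUnit K (m + 1))⁻¹ *
              hollowUnit K (m + 1)) := by rw [Matrix.nonsing_inv_mul _ hu, mul_one]
        _ = _ := by rw [← mul_assoc, Matrix.adjugate_mul, Matrix.smul_mul, one_mul]
    rw [SetLike.mem_coe, RingHom.mem_ker, h, hadj, Matrix.smul_apply,
      hollowUnit_apply_self, smul_zero]
  -- Universality applied to the quotient of the localization by the extended ideal, whose kernel is
  -- the contraction.
  · have hle := ker_inverseHom_le K ((Ideal.Quotient.mk
      ((principalMinorIdeal (genericMatrix K (m + 1)) m).map (algebraMap (CoordRing K (m + 1))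
        (Localization.Away (genericMatrix K (m + 1)).det)))).comp (algebraMap _ _))
      ((IsLocalization.Away.algebraMap_isUnit _).map (Ideal.Quotient.mk _))
      (fun p hp => Ideal.Quotient.eq_zero_iff_mem.2 (Ideal.mem_map_of_mem _ hp))
    exact Ideal.mem_comap.2 (Ideal.Quotient.eq_zero_iff_mem.1 (hle hf))

lemma isDomain_hollowLocalization (m : ℕ) :
    IsDomain (Localization.Away (hollowMatrix K (m + 2)).det) :=
  IsLocalization.isDomain_localization
    (powers_le_nonZeroDivisors_of_noZeroDivisors (det_hollowMatrix_ne_zero K m))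

instance isPrime_contractedIdeal (m : ℕ) : (contractedIdeal K (m + 2) (m + 1)).IsPrime := by
  rw [contractedIdeal_eq_ker]
  have := isDomain_hollowLocalization K m
  exact RingHom.ker_isPrime _

lemma det_notMem_contractedIdeal (m : ℕ) :
    (genericMatrix K (m + 2)).det ∉ contractedIdeal K (m + 2) (m + 1) := by
  rw [contractedIdeal_eq_ker]
  have := isDomain_hollowLocalization K m
  exact fun h => (isUnit_inverseHom_det K (m + 2)).ne_zero h

lemma contractedIdeal_mem_minimalPrimes (m : ℕ) :
    contractedIdeal K (m + 2) (m + 1) ∈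
      (principalMinorIdeal (genericMatrix K (m + 2)) (m + 1)).minimalPrimes := by
  refine ⟨⟨inferInstance, principalMinorIdeal_le_contractedIdeal K _ _⟩, fun p hp hpQ => ?_⟩
  have := hp.1
  exact contractedIdeal_le_of_det_notMem K p hp.2
    fun h => det_notMem_contractedIdeal K m (hpQ h)

lemma height_le_of_mem_minimalPrimes_principalMinorIdeal {m : ℕ}
    {p : Ideal (CoordRing K (m + 1))}
    (hp : p ∈ (principalMinorIdeal (genericMatrix K (m + 1)) m).minimalPrimes) :
    p.height ≤ (m + 1 : ℕ) := by
  rw [principalMinorIdeal_eq_span_adjugate] at hp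
  refine (Ideal.height_le_card_of_mem_minimalPrimes_span (Set.finite_range _) hp).trans ?_
  rw [← Set.image_univ]
  exact_mod_cast (Set.ncard_image_le (Set.toFinite _)).trans_eq (by simp)

/-- Krull gives the upper bound. For the lower one, the generic matrix is the inverse of one with n²
- n off-diagonal entries, where n = m + 2. -/
theorem height_contractedIdeal (m : ℕ) :
    (contractedIdeal K (m + 2) (m + 1)).height = (m + 2 : ℕ) := by
  classical
  refine le_antisymm (height_le_of_mem_minimalPrimes_principalMinorIdeal K
    (contractedIdeal_mem_minimalPrimes K m)) ?_
  have := isDomain_hollowLocalization K m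
  set D := Localization.Away (hollowMatrix K (m + 2)).det
  set L := FractionRing D
  let φ : CoordRing K (m + 2) →ₐ[K] L := (IsScalarTower.toAlgHom K D L).comp (inverseHom K (m + 2))
  have hker : RingHom.ker φ = contractedIdeal K (m + 2) (m + 1) := by
    rw [contractedIdeal_eq_ker]
    ext f
    simp only [RingHom.mem_ker, φ, AlgHom.comp_apply, IsScalarTower.coe_toAlgHom']
    exact map_eq_zero_iff _ (IsFractionRing.injective D L)
  set Z := (hollowUnit K (m + 2)).map (algebraMap D L) with hZ
  have hφ : ∀ p, φ (MvPolynomial.X p) = Z⁻¹ p.1 p.2 := by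
    intro p
    rw [hZ, ← map_inv_of_isUnit_det _ (isUnit_det_hollowUnit K (m + 2))]
    simp [φ, inverseHom]
  let s : Finset L := (Finset.univ.offDiag).image fun p : Fin (m + 2) × Fin (m + 2) => Z p.1 p.2
  have hs : s.card ≤ (m + 2) * (m + 2) - (m + 2) := by
    refine Finset.card_image_le.trans_eq ?_
    simp [Finset.offDiag_card]
  have h := card_le_height_ker_add φ s fun p => by
    rw [hφ]
    refine inv_apply_mem _ _ (fun i j => ?_) _ _
    by_cases hij : i = j
    · have : Z i j = 0 := by
        rw [hij, hZ, Matrix.map_apply, hollowUnit_apply_self, map_zero]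
      rw [this]
      exact zero_mem _
    · exact IntermediateField.subset_adjoin K _
        (Finset.mem_coe.2 (Finset.mem_image.2 ⟨(i, j), by simp [hij], rfl⟩))
  rw [hker, Nat.card_prod, Nat.card_fin] at h
  have h2 : (((m + 2) + ((m + 2) * (m + 2) - (m + 2)) : ℕ) : ℕ∞) ≤
      (contractedIdeal K (m + 2) (m + 1)).height + (((m + 2) * (m + 2) - (m + 2) : ℕ) : ℕ∞) := by
    rw [Nat.add_sub_of_le (Nat.le_mul_self _)]
    exact h.trans (by gcongr)
  rw [Nat.cast_add] at h2
  exact (ENat.add_le_add_iff_right (ENat.natCast_ne_top _)).1 h2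

end Contracted

end PrincipalMinors

/-! ### Kernels and bordered minors over a field -/

namespace PrincipalMinors

open Matrix

section RankOverField

variable {L : Type*} [Field L]

lemma rank_lt_of_det_eq_zero {n : ℕ} {M : Matrix (Fin n) (Fin n) L} (h : M.det = 0) :
    M.rank < n := by
  obtain ⟨u, hu, hMu⟩ := exists_mulVec_eq_zero_iff.2 h
  have h1 := M.mulVecLin.finrank_range_add_finrank_ker
  rw [Module.finrank_fin_fun] at h1
  have h2 : 0 < Module.finrank L M.mulVecLin.ker := by
    have : Nontrivial M.mulVecLin.ker :=
      ⟨⟨⟨u, hMu⟩, 0, fun h => hu (congrArg Subtype.val h)⟩⟩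
    exact Module.finrank_pos
  rw [Matrix.rank]
  omega

lemma rank_eq_iff_det_ne_zero {n : ℕ} {M : Matrix (Fin n) (Fin n) L} :
    M.rank = n ↔ M.det ≠ 0 := by
  refine ⟨fun h h0 => (rank_lt_of_det_eq_zero h0).ne h, fun h => ?_⟩
  rw [rank_of_isUnit M ((isUnit_iff_isUnit_det M).2 (isUnit_iff_ne_zero.2 h)), Fintype.card_fin]

lemma le_rank_of_det_submatrix_ne_zero {n t : ℕ} {M : Matrix (Fin n) (Fin n) L}
    (f g : Fin t → Fin n) (h : (M.submatrix f g).det ≠ 0) : t ≤ M.rank :=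
  (rank_eq_iff_det_ne_zero.2 h).symm.trans_le (rank_submatrix_le M f g)

/-- For a matrix of corank one whose principal minors of corank one vanish, generators of the two
kernels have disjoint supports. -/
lemma exists_kernel_vectors {m : ℕ} {M : Matrix (Fin (m + 1)) (Fin (m + 1)) L}
    (hrank : M.rank = m) (hadj : ∀ i, M.adjugate i i = 0) :
    ∃ u v : Fin (m + 1) → L, u ≠ 0 ∧ v ≠ 0 ∧ M *ᵥ u = 0 ∧ v ᵥ* M = 0 ∧ ∀ i, u i * v i = 0 := by
  have hdet : M.det = 0 := by
    by_contra h
    have := rank_eq_iff_det_ne_zero.2 h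
    omega
  obtain ⟨u, hu, hMu⟩ := exists_mulVec_eq_zero_iff.2 hdet
  obtain ⟨v, hv, hvM⟩ := exists_vecMul_eq_zero_iff.2 hdet
  refine ⟨u, v, hu, hv, hMu, hvM, fun i => ?_⟩
  by_contra huv
  obtain ⟨hui, hvi⟩ := mul_ne_zero_iff.1 huv
  have hker : Module.finrank L M.mulVecLin.ker = 1 := by
    have h1 := M.mulVecLin.finrank_range_add_finrank_ker
    rw [Module.finrank_fin_fun] at h1
    rw [Matrix.rank] at hrank
    omega
  have hi := hadj i
  rw [adjugate_fin_succ_eq_det_submatrix, Even.neg_one_pow ⟨_, rfl⟩, one_mul,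
    ← exists_mulVec_eq_zero_iff] at hi
  obtain ⟨w, hw, hMw⟩ := hi
  -- All rows but the i-th kill `w'`, and `v` with `v i ≠ 0` expresses that row by the others. So
  -- `w'` lies on the line spanned by `u`, yet vanishes at i where `u` does not.
  set w' : Fin (m + 1) → L := i.insertNth 0 w with hw'
  have h1 : ∀ k, (M *ᵥ w') (i.succAbove k) = 0 := by
    intro k
    have := congrFun hMw k
    rw [mulVec, dotProduct] at this ⊢
    rw [Fin.sum_univ_succAbove _ i]
    simpa [hw'] using this
  have h2 : (M *ᵥ w') i = 0 := by
    have : v ⬝ᵥ (M *ᵥ w') = 0 := by rw [dotProduct_mulVec, hvM, zero_dotProduct]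
    rw [dotProduct, Fin.sum_univ_succAbove _ i] at this
    simp only [h1, mul_zero, Finset.sum_const_zero, add_zero] at this
    exact (mul_eq_zero.1 this).resolve_left hvi
  have h3 : M *ᵥ w' = 0 := by
    funext k
    rcases Fin.eq_self_or_eq_succAbove i k with rfl | ⟨k, rfl⟩
    · exact h2
    · exact h1 k
  obtain ⟨c, hc⟩ := (finrank_eq_one_iff_of_nonzero' (⟨u, hMu⟩ : M.mulVecLin.ker)
    fun h => hu (congrArg Subtype.val h)).1 hker ⟨w', h3⟩
  have hc' : c • u = w' := congrArg Subtype.val hc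
  have hc0 : c = 0 := by
    have := congrFun hc' i
    simp only [hw', Pi.smul_apply, smul_eq_mul, Fin.insertNth_apply_same] at this
    exact (mul_eq_zero.1 this).resolve_right hui
  refine hw (funext fun k => ?_)
  have := congrFun hc' (i.succAbove k)
  rw [hc0, zero_smul] at this
  simpa [hw'] using this.symm

/-- The row indices of a minor of size `r + 1` that borders the leading minor of size `r`. -/
def borderEmb (r : ℕ) (a : Fin 2) : Fin (r + 1) ↪o Fin (r + 2) :=
  -- Omitting one of the last two indices keeps the other, hence `a.rev`.
  Fin.succAboveOrderEmb (Fin.natAdd r a.rev)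

lemma borderEmb_castAdd {r : ℕ} (a : Fin 2) (k : Fin r) :
    borderEmb r a (Fin.castAdd 1 k) = Fin.castAdd 2 k := by
  fin_cases a <;> simp [borderEmb, Fin.succAbove, Fin.ext_iff, Fin.lt_def]

lemma borderEmb_natAdd {r : ℕ} (a : Fin 2) (k : Fin 1) :
    borderEmb r a (Fin.natAdd r k) = Fin.natAdd r a := by
  fin_cases a <;> fin_cases k <;>
    simp [borderEmb, Fin.succAbove, Fin.ext_iff, Fin.lt_def]

/-- If the minors that border an invertible block of size `r` vanish, then so do all minors of
size `r + 1`. -/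
lemma det_submatrix_eq_zero_of_bordered {r : ℕ} {M : Matrix (Fin (r + 2)) (Fin (r + 2)) L}
    (hA : (M.submatrix (Fin.castAdd 2) (Fin.castAdd 2)).det ≠ 0)
    (hb : ∀ a b, (M.submatrix (borderEmb r a) (borderEmb r b)).det = 0)
    (f g : Fin (r + 1) → Fin (r + 2)) : (M.submatrix f g).det = 0 := by
  set A : Matrix (Fin r) (Fin r) L := M.submatrix (Fin.castAdd 2) (Fin.castAdd 2) with hAdef
  set P : Matrix (Fin (r + 2)) (Fin r) L := M.submatrix id (Fin.castAdd 2) with hP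
  set Q : Matrix (Fin r) (Fin (r + 2)) L := M.submatrix (Fin.castAdd 2) id with hQ
  have hAu : IsUnit A.det := isUnit_iff_ne_zero.2 hA
  -- Only the lower right 2 × 2 corner needs the hypothesis: there the equation says that the Schur
  -- complement of `A` in a bordered minor is zero.
  have hM : M = P * (A⁻¹ * Q) := by
    ext i j
    refine Fin.addCases (fun i => ?_) (fun a => ?_) i
    · have : (P * (A⁻¹ * Q)).submatrix (Fin.castAdd 2) id = Q := by
        rw [← Matrix.mul_assoc, submatrix_mul _ _ _ id _ Function.bijective_id,
          submatrix_mul _ _ _ id _ Function.bijective_id]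
        change A * A⁻¹ * Q = Q
        rw [mul_nonsing_inv _ hAu, Matrix.one_mul]
      exact (congrFun (congrFun this i) j).symm
    · refine Fin.addCases (fun j => ?_) (fun b => ?_) j
      · have : (P * (A⁻¹ * Q)).submatrix id (Fin.castAdd 2) = P := by
          rw [submatrix_mul _ _ _ id _ Function.bijective_id,
            submatrix_mul _ _ _ id _ Function.bijective_id]
          change P * (A⁻¹ * A) = P
          rw [nonsing_inv_mul _ hAu, Matrix.mul_one]
        exact (congrFun (congrFun this (Fin.natAdd r a)) j).symm
      · have h := hb a b
        let := invertibleOfIsUnitDet A hAu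
        have hblock : (M.submatrix (borderEmb r a) (borderEmb r b)).submatrix finSumFinEquiv
            finSumFinEquiv = fromBlocks A
              (M.submatrix (Fin.castAdd 2) fun _ : Fin 1 => Fin.natAdd r b)
              (M.submatrix (fun _ : Fin 1 => Fin.natAdd r a) (Fin.castAdd 2))
              (M.submatrix (fun _ : Fin 1 => Fin.natAdd r a) fun _ : Fin 1 => Fin.natAdd r b) := by
          ext i j
          rcases i with i | i <;> rcases j with j | j <;>
            simp [borderEmb_castAdd, borderEmb_natAdd, hAdef, -Fin.natAdd_eq_addNat]
        rw [← det_submatrix_equiv_self finSumFinEquiv, hblock, det_fromBlocks₁₁, mul_eq_zero,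
          or_iff_right hA, det_fin_one, Matrix.sub_apply, sub_eq_zero, invOf_eq_nonsing_inv,
          Matrix.mul_assoc] at h
        exact h
  rw [hM, submatrix_mul _ _ f id g Function.bijective_id]
  exact det_mul_eq_zero_of_card_lt (by simp) _ _

end RankOverField

/-! ### The height of the determinantal ideal -/

section Determinantal

variable (K : Type*) [Field K]

lemma det_rightFactor_ne_zero (r : ℕ) :
    ((rightFactor K (r + 2) r).submatrix id (Fin.castAdd 2)).det ≠ 0 := by
  intro h
  have h' := congrArg (MvPolynomial.eval
    (Sum.elim 0 fun p : Fin r × Fin (r + 2) => if p.1.val = p.2.val then (1 : K) else 0)) h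
  rw [RingHom.map_det, map_zero] at h'
  refine one_ne_zero (α := K) (Eq.trans ?_ h')
  rw [← det_one (n := Fin r)]
  congr 1
  ext i j
  simp [rightFactor, one_apply, Fin.ext_iff]

lemma det_leftFactor_ne_zero (r : ℕ) :
    ((leftFactor K (r + 2) r).submatrix (Fin.castAdd 2) id).det ≠ 0 := by
  intro h
  have h' := congrArg (MvPolynomial.eval
    (Sum.elim (fun p : Fin r × Fin (r + 2) => if p.2.val = p.1.val then (1 : K) else 0) 0)) h
  rw [RingHom.map_det, map_zero] at h'
  refine one_ne_zero (α := K) (Eq.trans ?_ h')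
  rw [← det_one (n := Fin r)]
  congr 1
  ext i j
  simp [leftFactor, one_apply, Fin.ext_iff]

lemma leadingMinor_notMem_determinantalIdeal (r : ℕ) [NeZero r] :
    ((genericMatrix K (r + 2)).submatrix (Fin.castAdd 2) (Fin.castAdd 2)).det ∉
      determinantalIdeal (genericMatrix K (r + 2)) (r + 1) := by
  rw [determinantalIdeal_eq_ker, RingHom.mem_ker, AlgHom.map_det, AlgHom.mapMatrix_apply,
    ← submatrix_map, genericMatrix_map_factorHom,
    submatrix_mul _ _ _ id _ Function.bijective_id, det_mul]
  exact mul_ne_zero (det_leftFactor_ne_zero K r) (det_rightFactor_ne_zero K r)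

/-- I is minimal over the four minors bordering the leading one: a smaller prime containing them
omits the leading minor too, so it contains all minors of size r + 1. -/
lemma height_determinantalIdeal_le (r : ℕ) [NeZero r] :
    (determinantalIdeal (genericMatrix K (r + 2)) (r + 1)).height ≤ 4 := by
  set I := determinantalIdeal (genericMatrix K (r + 2)) (r + 1) with hI
  let b : Fin 2 × Fin 2 → CoordRing K (r + 2) := fun p =>
    ((genericMatrix K (r + 2)).submatrix (borderEmb r p.1) (borderEmb r p.2)).det
  have hmin : I ∈ (Ideal.span (Set.range b)).minimalPrimes := by
    refine ⟨⟨inferInstance, Ideal.span_mono ?_⟩, fun q hq hqI => ?_⟩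
    · rintro _ ⟨p, rfl⟩
      exact ⟨(borderEmb r p.1, borderEmb r p.2), rfl⟩
    · have := hq.1
      have hmem : ∀ f g : Fin (r + 1) → Fin (r + 2),
          ((genericMatrix K (r + 2)).submatrix f g).det ∈ q ↔
          (((genericMatrix K (r + 2)).map (algebraMap _ q.ResidueField)).submatrix f g).det = 0 := by
        intro f g
        rw [← Ideal.algebraMap_residueField_eq_zero, RingHom.map_det, RingHom.mapMatrix_apply,
          submatrix_map]
      rw [hI, determinantalIdeal, Ideal.span_le]
      rintro _ ⟨fg, rfl⟩
      refine (hmem _ _).2 (det_submatrix_eq_zero_of_bordered ?_ (fun a c => (hmem _ _).1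
        (hq.2 (Ideal.subset_span ⟨(a, c), rfl⟩))) _ _)
      rw [submatrix_map, ← RingHom.mapMatrix_apply, ← RingHom.map_det, Ne,
        Ideal.algebraMap_residueField_eq_zero]
      exact fun h => leadingMinor_notMem_determinantalIdeal K r (hqI h)
  refine (Ideal.height_le_card_of_mem_minimalPrimes_span (Set.finite_range _) hmin).trans ?_
  rw [← Set.image_univ]
  exact_mod_cast (Set.ncard_image_le (Set.toFinite _)).trans_eq (by simp)

/-- The generic matrix of rank r is determined by its first r columns and the 2r coefficients
expressing the last two through them, and (r + 2)² - r(r + 2) - 2r = 4. -/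
theorem height_determinantalIdeal (r : ℕ) [NeZero r] :
    (determinantalIdeal (genericMatrix K (r + 2)) (r + 1)).height = 4 := by
  classical
  refine le_antisymm (height_determinantalIdeal_le K r) ?_
  set W := MvPolynomial ((Fin r × Fin (r + 2)) ⊕ (Fin r × Fin (r + 2))) K
  set L := FractionRing W
  let φ : CoordRing K (r + 2) →ₐ[K] L :=
    (IsScalarTower.toAlgHom K W L).comp (factorHom K (r + 2) r)
  have hker : RingHom.ker φ = determinantalIdeal (genericMatrix K (r + 2)) (r + 1) := by
    rw [determinantalIdeal_eq_ker]
    ext f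
    simp only [RingHom.mem_ker, φ, AlgHom.comp_apply, IsScalarTower.coe_toAlgHom']
    exact map_eq_zero_iff _ (IsFractionRing.injective W L)
  set Y : Matrix (Fin (r + 2)) (Fin r) L := (leftFactor K (r + 2) r).map (algebraMap W L)
  set Z : Matrix (Fin r) (Fin (r + 2)) L := (rightFactor K (r + 2) r).map (algebraMap W L) with hZ
  set Z₁ : Matrix (Fin r) (Fin r) L := Z.submatrix id (Fin.castAdd 2) with hZ₁
  have hZ₁u : IsUnit Z₁.det := by
    rw [isUnit_iff_ne_zero, hZ₁, hZ, submatrix_map, ← RingHom.mapMatrix_apply, ← RingHom.map_det,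
      Ne, map_eq_zero_iff _ (IsFractionRing.injective W L)]
    exact det_rightFactor_ne_zero K r
  have hφ : ∀ i j, φ (MvPolynomial.X (i, j)) = (Y * Z) i j := by
    intro i j
    rw [← Matrix.map_mul, ← genericMatrix_map_factorHom]
    simp [φ]
  set T := Z₁⁻¹ * Z
  have hT : ∀ i j, (Y * Z) i j = ∑ k, (Y * Z) i (Fin.castAdd 2 k) * T k j := by
    intro i j
    have : Y * Z = (Y * Z₁) * T := by
      rw [Matrix.mul_assoc, ← Matrix.mul_assoc Z₁, mul_nonsing_inv _ hZ₁u, Matrix.one_mul]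
    conv_lhs => rw [this]
    rfl
  let s₁ : Finset L := Finset.univ.image fun p : Fin (r + 2) × Fin r =>
    (Y * Z) p.1 (Fin.castAdd 2 p.2)
  let s₂ : Finset L := Finset.univ.image fun p : Fin r × Fin 2 => T p.1 (Fin.natAdd r p.2)
  have hs : (s₁ ∪ s₂).card ≤ (r + 2) * r + r * 2 := by
    refine (Finset.card_union_le _ _).trans (add_le_add ?_ ?_) <;>
    · refine Finset.card_image_le.trans_eq ?_
      simp
  have hs₁ : ∀ i k, (Y * Z) i (Fin.castAdd 2 k) ∈
      IntermediateField.adjoin K ((s₁ ∪ s₂ : Finset L) : Set L) := fun i k =>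
    IntermediateField.subset_adjoin K _ (Finset.mem_coe.2 (Finset.mem_union_left _
      (Finset.mem_image.2 ⟨(i, k), Finset.mem_univ _, rfl⟩)))
  have h := card_le_height_ker_add φ (s₁ ∪ s₂) fun p => by
    obtain ⟨i, j⟩ := p
    rw [hφ]
    refine Fin.addCases (fun j => hs₁ i j) (fun j => ?_) j
    rw [hT]
    refine sum_mem fun k _ => mul_mem (hs₁ i k) (IntermediateField.subset_adjoin K _
      (Finset.mem_coe.2 (Finset.mem_union_right _
        (Finset.mem_image.2 ⟨(k, j), Finset.mem_univ _, rfl⟩))))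
  rw [hker, Nat.card_prod, Nat.card_fin] at h
  have h2 : ((4 + ((r + 2) * r + r * 2) : ℕ) : ℕ∞) ≤
      (determinantalIdeal (genericMatrix K (r + 2)) (r + 1)).height +
        (((r + 2) * r + r * 2 : ℕ) : ℕ∞) := by
    rw [show 4 + ((r + 2) * r + r * 2) = (r + 2) * (r + 2) by ring]
    exact h.trans (by gcongr)
  rw [Nat.cast_add] at h2
  exact (ENat.add_le_add_iff_right (ENat.natCast_ne_top _)).1 h2

end Determinantal

/-! ### Points of rank n - 1 -/

section CorankOne

variable {K : Type*} [Field K]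

lemma rankAt_eq_iff_det_notMem {n : ℕ} (p : PrimeSpectrum (CoordRing K n)) :
    rankAt p = n ↔ (genericMatrix K n).det ∉ p.asIdeal := by
  rw [rankAt, rank_eq_iff_det_ne_zero, ← RingHom.mapMatrix_apply, ← RingHom.map_det, Ne,
    Ideal.algebraMap_residueField_eq_zero]

lemma rankAt_eq_of_not_determinantalIdeal_le {m : ℕ} (p : PrimeSpectrum (CoordRing K (m + 1)))
    (hdet : (genericMatrix K (m + 1)).det ∈ p.asIdeal)
    (hI : ¬ determinantalIdeal (genericMatrix K (m + 1)) m ≤ p.asIdeal) : rankAt p = m := by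
  rw [determinantalIdeal, Ideal.span_le, Set.not_subset] at hI
  obtain ⟨_, ⟨fg, rfl⟩, hfg⟩ := hI
  have hne : rankAt p ≠ m + 1 := fun h => (rankAt_eq_iff_det_notMem p).1 h hdet
  have hle : rankAt p ≤ m + 1 := (rank_le_width _)
  have hge : m ≤ rankAt p := by
    refine le_rank_of_det_submatrix_ne_zero fg.1 fg.2 ?_
    rw [submatrix_map, ← RingHom.mapMatrix_apply, ← RingHom.map_det, Ne,
      Ideal.algebraMap_residueField_eq_zero]
    exact hfg
  omega

/-- The kernel relations recover one column and one row from the remaining m² entries, and the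
scaled kernel vectors need m - 1 further parameters; (m + 1)² - m² - (m - 1) = m + 2. -/
theorem height_ge_of_rankAt_eq {m : ℕ} (p : PrimeSpectrum (CoordRing K (m + 1)))
    (hp : principalMinorIdeal (genericMatrix K (m + 1)) m ≤ p.asIdeal) (hrank : rankAt p = m) :
    ((m + 2 : ℕ) : ℕ∞) ≤ p.asIdeal.height := by
  classical
  set L := p.asIdeal.ResidueField
  set M := (genericMatrix K (m + 1)).map (algebraMap (CoordRing K (m + 1)) L) with hM
  have hadj : ∀ i, M.adjugate i i = 0 := by
    intro i
    rw [hM, ← RingHom.mapMatrix_apply, ← RingHom.map_adjugate, RingHom.mapMatrix_apply,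
      Matrix.map_apply, Ideal.algebraMap_residueField_eq_zero]
    rw [principalMinorIdeal_eq_span_adjugate] at hp
    exact hp (Ideal.subset_span ⟨i, rfl⟩)
  obtain ⟨u, v, hu, hv, hMu, hvM, huv⟩ := exists_kernel_vectors hrank hadj
  obtain ⟨i₀, hi₀⟩ := Function.ne_iff.1 hu
  obtain ⟨j₀, hj₀⟩ := Function.ne_iff.1 hv
  rw [Pi.zero_apply] at hi₀ hj₀
  have hij : i₀ ≠ j₀ := fun h => (mul_ne_zero hi₀ (h ▸ hj₀)) (huv i₀)
  -- normalize the two vectors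
  obtain ⟨u', hu'₀, hMu', hu'⟩ : ∃ u' : Fin (m + 1) → L, u' i₀ = 1 ∧ M *ᵥ u' = 0 ∧
      ∀ i, u' i = 0 ↔ u i = 0 :=
    ⟨(u i₀)⁻¹ • u, by simp [hi₀], by rw [mulVec_smul, hMu, smul_zero], by simp [hi₀]⟩
  obtain ⟨v', hv'₀, hvM', hv'⟩ : ∃ v' : Fin (m + 1) → L, v' j₀ = 1 ∧ v' ᵥ* M = 0 ∧
      ∀ i, v' i = 0 ↔ v i = 0 :=
    ⟨(v j₀)⁻¹ • v, by simp [hj₀], by rw [smul_vecMul, hvM, smul_zero], by simp [hj₀]⟩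
  have huv' : ∀ i, u' i = 0 ∨ v' i = 0 := by
    intro i
    rw [hu', hv']
    exact mul_eq_zero.1 (huv i)
  let φ : CoordRing K (m + 1) →ₐ[K] L := IsScalarTower.toAlgHom K (CoordRing K (m + 1)) L
  have hker : RingHom.ker φ = p.asIdeal := Ideal.ker_algebraMap_residueField p.asIdeal
  have hφ : ∀ i j, φ (MvPolynomial.X (i, j)) = M i j := by
    intro i j
    simp [φ, hM]
  let s₁ : Finset L := (Finset.univ.erase j₀ ×ˢ Finset.univ.erase i₀).image fun q => M q.1 q.2
  -- Since one summand is always zero, the sum records both coordinates. At i₀ and j₀ both vectors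
  -- are already known to be 0 or 1.
  let s₂ : Finset L := ((Finset.univ.erase i₀).erase j₀).image fun i => u' i + v' i
  have hs : (s₁ ∪ s₂).card ≤ m * m + (m - 1) := by
    refine (Finset.card_union_le _ _).trans (add_le_add ?_ ?_)
    · refine Finset.card_image_le.trans_eq ?_
      simp [Finset.card_product, Finset.card_erase_of_mem]
    · refine Finset.card_image_le.trans_eq ?_
      rw [Finset.card_erase_of_mem (by simp [hij.symm]), Finset.card_erase_of_mem (by simp)]
      simp
  set F := IntermediateField.adjoin K ((s₁ ∪ s₂ : Finset L) : Set L)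
  have hsum : ∀ i, i ≠ i₀ → i ≠ j₀ → u' i + v' i ∈ F := fun i h1 h2 =>
    IntermediateField.subset_adjoin K _ (Finset.mem_coe.2 (Finset.mem_union_right _
      (Finset.mem_image.2 ⟨i, by simp [h1, h2], rfl⟩)))
  have huF : ∀ i, u' i ∈ F := by
    intro i
    by_cases h1 : i = i₀
    · rw [h1, hu'₀]; exact one_mem _
    · rcases huv' i with h | h
      · rw [h]; exact zero_mem _
      · have h2 : i ≠ j₀ := fun h2 => by rw [h2, hv'₀] at h; exact one_ne_zero h
        simpa [h] using hsum i h1 h2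
  have hvF : ∀ i, v' i ∈ F := by
    intro i
    by_cases h1 : i = j₀
    · rw [h1, hv'₀]; exact one_mem _
    · rcases huv' i with h | h
      · have h2 : i ≠ i₀ := fun h2 => by rw [h2, hu'₀] at h; exact one_ne_zero h
        simpa [h] using hsum i h2 h1
      · rw [h]; exact zero_mem _
  -- Column i₀ off row j₀ comes from `M *ᵥ u' = 0`; afterwards row j₀ comes from `v' ᵥ* M = 0`.
  have hMF₁ : ∀ i j, i ≠ j₀ → M i j ∈ F := by
    have hne : ∀ i j, i ≠ j₀ → j ≠ i₀ → M i j ∈ F := fun i j h1 h2 =>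
      IntermediateField.subset_adjoin K _ (Finset.mem_coe.2 (Finset.mem_union_left _
        (Finset.mem_image.2 ⟨(i, j), by simp [h1, h2], rfl⟩)))
    intro i j hi
    by_cases hj : j = i₀
    · have h := congrFun hMu' i
      rw [mulVec, dotProduct, ← Finset.add_sum_erase _ _ (Finset.mem_univ i₀), hu'₀, mul_one,
        Pi.zero_apply, add_eq_zero_iff_eq_neg] at h
      rw [hj, h]
      exact neg_mem (sum_mem fun k hk => mul_mem (hne i k hi (Finset.ne_of_mem_erase hk)) (huF k))
    · exact hne i j hi hj
  have hMF : ∀ i j, M i j ∈ F := by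
    intro i j
    by_cases hi : i = j₀
    · have h := congrFun hvM' j
      rw [vecMul, dotProduct, ← Finset.add_sum_erase _ _ (Finset.mem_univ j₀), hv'₀, one_mul,
        Pi.zero_apply, add_eq_zero_iff_eq_neg] at h
      rw [hi, h]
      exact neg_mem (sum_mem fun k hk => mul_mem (hvF k) (hMF₁ k j (Finset.ne_of_mem_erase hk)))
    · exact hMF₁ i j hi
  have h := card_le_height_ker_add φ (s₁ ∪ s₂) fun q => by
    rw [hφ q.1 q.2]
    exact hMF _ _
  rw [hker, Nat.card_prod, Nat.card_fin] at h
  have hm : 1 ≤ m := by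
    have h1 := i₀.isLt
    have h2 := j₀.isLt
    have h3 := Fin.val_ne_of_ne hij
    omega
  have h2 : (((m + 2) + (m * m + (m - 1)) : ℕ) : ℕ∞) ≤
      p.asIdeal.height + ((m * m + (m - 1) : ℕ) : ℕ∞) := by
    have : (m + 2) + (m * m + (m - 1)) = (m + 1) * (m + 1) := by
      have : (m + 1) * (m + 1) = m * m + 2 * m + 1 := by ring
      omega
    rw [this]
    exact h.trans (by gcongr)
  rw [Nat.cast_add] at h2
  exact (ENat.add_le_add_iff_right (ENat.natCast_ne_top _)).1 h2

end CorankOne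

end PrincipalMinors

/-! ### Minimal primes and vanishing ideals -/

namespace PrincipalMinors

variable {K : Type*} [Field K]

theorem minimalPrimes_principalMinorIdeal (r : ℕ) (hr : 2 ≤ r) :
    (principalMinorIdeal (genericMatrix K (r + 2)) (r + 1)).minimalPrimes =
      {determinantalIdeal (genericMatrix K (r + 2)) (r + 1),
        contractedIdeal K (r + 2) (r + 1)} := by
  have : NeZero r := ⟨by omega⟩
  set P := principalMinorIdeal (genericMatrix K (r + 2)) (r + 1)
  set I := determinantalIdeal (genericMatrix K (r + 2)) (r + 1)
  have hIheight : I.height = 4 := height_determinantalIdeal K r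
  have hIQ : ¬ contractedIdeal K (r + 2) (r + 1) ≤ I := by
    intro hle
    rcases hle.eq_or_lt with h | h
    · exact det_notMem_contractedIdeal K r (h ▸ det_mem_determinantalIdeal _)
    -- Here n ≥ 4 enters: the heights n and 4 exclude a strict inclusion.
    · have := Ideal.height_add_one_le_of_lt_of_isPrime h
      rw [height_contractedIdeal, hIheight] at this
      have h' : r + 2 + 1 ≤ 4 := by exact_mod_cast this
      omega
  have hsub : ∀ p ∈ P.minimalPrimes, p = I ∨ p = contractedIdeal K (r + 2) (r + 1) := by
    intro p hp
    have hpr := hp.1.1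
    by_cases hdet : (genericMatrix K (r + 2)).det ∈ p
    · by_cases hI : I ≤ p
      · exact Or.inl (le_antisymm (hp.2 ⟨inferInstance,
          principalMinorIdeal_le_determinantalIdeal _ _⟩ hI) hI)
      · have h1 := height_ge_of_rankAt_eq ⟨p, hpr⟩ hp.1.2
          (rankAt_eq_of_not_determinantalIdeal_le ⟨p, hpr⟩ hdet hI)
        have h2 := h1.trans (height_le_of_mem_minimalPrimes_principalMinorIdeal K hp)
        have h' : r + 1 + 2 ≤ r + 1 + 1 := by exact_mod_cast h2
        omega
    · have hQ := contractedIdeal_le_of_det_notMem K p hp.1.2 hdet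
      exact Or.inr (le_antisymm (hp.2 ⟨inferInstance,
        principalMinorIdeal_le_contractedIdeal K _ _⟩ hQ) hQ)
  refine Set.Subset.antisymm hsub ?_
  rintro _ (rfl | rfl)
  -- I contains some minimal prime, and this cannot be Q.
  · obtain ⟨p, hp, hpI⟩ := Ideal.exists_minimalPrimes_le
      (principalMinorIdeal_le_determinantalIdeal (genericMatrix K (r + 2)) (r + 1))
    rcases hsub p hp with rfl | rfl
    · exact hp
    · exact absurd hpI hIQ
  · exact contractedIdeal_mem_minimalPrimes K r

theorem contractedIdeal_eq_vanishingIdeal_closure (r : ℕ) :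
    contractedIdeal K (r + 2) (r + 1) =
      PrimeSpectrum.vanishingIdeal (closure (rankStratum K (r + 2) (r + 2) (r + 1))) := by
  rw [PrimeSpectrum.vanishingIdeal_closure]
  refine le_antisymm (fun f hf => ?_) fun f hf => ?_
  · rw [PrimeSpectrum.mem_vanishingIdeal]
    rintro p ⟨hp, hrank⟩
    exact contractedIdeal_le_of_det_notMem K p.asIdeal hp ((rankAt_eq_iff_det_notMem p).1 hrank) hf
  · rw [PrimeSpectrum.mem_vanishingIdeal] at hf
    -- Q is itself a point of the stratum, its generic point.
    exact hf ⟨_, isPrime_contractedIdeal K r⟩ ⟨principalMinorIdeal_le_contractedIdeal K _ _,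
      (rankAt_eq_iff_det_notMem _).2 (det_notMem_contractedIdeal K r)⟩

lemma aeval_det_submatrix_genericMatrix {n t : ℕ} (x : Fin n × Fin n → K) (f g : Fin t → Fin n) :
    MvPolynomial.aeval x ((genericMatrix K n).submatrix f g).det =
      ((Matrix.of fun i j => x (i, j)).submatrix f g).det := by
  rw [AlgHom.map_det, AlgHom.mapMatrix_apply, ← Matrix.submatrix_map]
  congr 2
  ext i j
  simp

theorem contractedIdeal_eq_vanishingIdeal_invertiblePoints [IsAlgClosed K] (r : ℕ) :
    contractedIdeal K (r + 2) (r + 1) =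
      MvPolynomial.vanishingIdeal K (invertiblePoints K (r + 2) (r + 1)) := by
  have hdet : ∀ x : Fin (r + 2) × Fin (r + 2) → K,
      MvPolynomial.aeval x (genericMatrix K (r + 2)).det =
        (Matrix.of fun i j => x (i, j)).det := fun x => aeval_det_submatrix_genericMatrix x id id
  refine le_antisymm (fun f hf => ?_) fun f hf => ?_
  · rw [MvPolynomial.mem_vanishingIdeal_iff]
    rintro x ⟨hx, hx'⟩
    refine contractedIdeal_le_ker (MvPolynomial.aeval x).toRingHom ((hdet x).symm ▸ hx) ?_ hf
    rw [principalMinorIdeal, Ideal.span_le]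
    rintro _ ⟨g, rfl⟩
    exact (aeval_det_submatrix_genericMatrix x g g).trans (hx' g)
  -- Multiplying by det X makes f vanish on the whole zero locus, so the Nullstellensatz applies; Q
  -- is prime and omits det X, which can then be cancelled.
  · have hmem : f * (genericMatrix K (r + 2)).det ∈
        (principalMinorIdeal (genericMatrix K (r + 2)) (r + 1)).radical := by
      rw [← MvPolynomial.vanishingIdeal_zeroLocus_eq_radical (K := K),
        MvPolynomial.mem_vanishingIdeal_iff]
      intro x hx
      rw [map_mul, hdet]
      by_cases h0 : (Matrix.of fun i j => x (i, j)).det = 0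
      · rw [h0, mul_zero]
      · rw [MvPolynomial.mem_vanishingIdeal_iff.1 hf x ⟨isUnit_iff_ne_zero.2 h0, fun g => ?_⟩,
          zero_mul]
        rw [← aeval_det_submatrix_genericMatrix]
        exact hx _ (Ideal.subset_span ⟨g, rfl⟩)
    have hQ := (isPrime_contractedIdeal K r).radical_le_iff.2
      (principalMinorIdeal_le_contractedIdeal K _ _) hmem
    exact ((isPrime_contractedIdeal K r).mem_or_mem hQ).resolve_right
      (det_notMem_contractedIdeal K r)

end PrincipalMinors

theorem theorem3p5 {K : Type*} [Field K] [IsAlgClosed K] (n : ℕ) (hn : 4 ≤ n) :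
    -- the minimal primes are exactly the two ideals, which are distinct
    (PrincipalMinors.principalMinorIdeal (PrincipalMinors.genericMatrix K n) (n - 1)).minimalPrimes
        = {PrincipalMinors.determinantalIdeal (PrincipalMinors.genericMatrix K n) (n - 1),
            PrincipalMinors.contractedIdeal K n (n - 1)} ∧
    PrincipalMinors.determinantalIdeal (PrincipalMinors.genericMatrix K n) (n - 1)
        ≠ PrincipalMinors.contractedIdeal K n (n - 1) ∧
    -- their heights
    (PrincipalMinors.determinantalIdeal (PrincipalMinors.genericMatrix K n) (n - 1)).height = 4 ∧
    (PrincipalMinors.contractedIdeal K n (n - 1)).height = (n : ℕ∞) ∧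
    -- the second one is the ideal of the closure of the invertible matrices, in the spectrum
    -- and in terms of matrices over the field
    PrincipalMinors.contractedIdeal K n (n - 1)
        = PrimeSpectrum.vanishingIdeal (closure (PrincipalMinors.rankStratum K n n (n - 1))) ∧
    PrincipalMinors.contractedIdeal K n (n - 1)
        = MvPolynomial.vanishingIdeal K (PrincipalMinors.invertiblePoints K n (n - 1)) ∧
    -- irreducible closed subsets of generic rank `n - 1` are too small to be components
    (∀ p ∈ PrincipalMinors.rankStratum K n (n - 1) (n - 1),
      ((n + 1 : ℕ) : ℕ∞) ≤ p.asIdeal.height ∧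
      p.asIdeal ∉ (PrincipalMinors.principalMinorIdeal
        (PrincipalMinors.genericMatrix K n) (n - 1)).minimalPrimes) := by
  obtain ⟨r, rfl⟩ : ∃ r, n = r + 2 := ⟨n - 2, by omega⟩
  have hr : 2 ≤ r := by omega
  have : NeZero r := ⟨by omega⟩
  rw [show r + 2 - 1 = r + 1 from rfl]
  refine ⟨PrincipalMinors.minimalPrimes_principalMinorIdeal r hr, fun h => ?_,
    PrincipalMinors.height_determinantalIdeal K r, PrincipalMinors.height_contractedIdeal K r,
    PrincipalMinors.contractedIdeal_eq_vanishingIdeal_closure r,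
    PrincipalMinors.contractedIdeal_eq_vanishingIdeal_invertiblePoints r, fun p hp => ?_⟩
  · exact PrincipalMinors.det_notMem_contractedIdeal K r
      (h ▸ PrincipalMinors.det_mem_determinantalIdeal _)
  · have hge := PrincipalMinors.height_ge_of_rankAt_eq p hp.1 hp.2
    refine ⟨hge, fun hmin => ?_⟩
    have hle := hge.trans
      (PrincipalMinors.height_le_of_mem_minimalPrimes_principalMinorIdeal K hmin)
    have h : r + 1 + 2 ≤ r + 1 + 1 := by exact_mod_cast hle
    omega
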